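/- Let $K$ be a field of characteristic $0$ and let $K\langle X\rangle=K\langle x_1,x_2,\ldots\rangle$ be the free unital associative algebra of countable rank over $K$. For an associative unital $K$-algebra $R$ let $T(R)\subseteq K\langle X\rangle$ be the ideal of all polynomial identities of $R$, that is, of all $f(x_1,\ldots,x_d)$ with $f(r_1,\ldots,r_d)=0$ for all $r_1,\ldots,r_d\in R$; $R$ is called a PI-algebra if $T(R)\neq 0$. Let $P_n$ be the $K$-span of the monomials $x_{\sigma(1)}\cdots x_{\sigma(n)}$, $\sigma\in S_n$, and put $$c_n(R)=\dim_K\bigl(P_n/(P_n\cap T(R))\bigr),\qquad c(R,t)=\sum_{n\ge 0}c_n(R)t^n\in\mathbb C[[t]].$$ A series in $\mathbb C[[t]]$ is called rational if it belongs to $\mathbb C(t)$, and algebraic if it is algebraic over $\mathbb C(t)$ (both inside $\mathbb C((t))$). Let $R_1,R_2,R$ be unital PI-algebras over $K$ such that $T(R)=T(R_1)T(R_2)$ (product of ideals). If $c(R_1,t)$ and $c(R_2,t)$ are rational, then $c(R,t)$ is rational. If $c(R_1,t)$ is rational and $c(R_2,t)$ is algebraic, then $c(R,t)$ is algebraic.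 -/

import Mathlib

/-- The set `T(R)` of all polynomial identities of the unital `K`-algebra `R`, inside the free unital
associative algebra `K⟨X⟩` of countable rank (the variables are indexed by `ℕ`): all `f` that vanish
under every substitution of elements of `R` for the variables.

It is recorded as a `K`-subspace of `K⟨X⟩`, so that the product of two such sets is Mathlib's product
of subspaces, the `K`-span of all products `f * g`, which for two-sided ideals is the product of
ideals. -/
def identitiesOf (K : Type*) [Field K] (R : Type*) [Ring R] [Algebra K R] :
    Submodule K (FreeAlgebra K ℕ) where
  carrier := {f | ∀ r : ℕ → R, FreeAlgebra.lift K r f = 0}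
  add_mem' := fun {f g} hf hg r => by rw [map_add, hf r, hg r, add_zero]
  zero_mem' := fun r => map_zero _
  smul_mem' := fun a f hf r => by rw [map_smul, hf r, smul_zero]

/-- `R` is a PI-algebra: it satisfies a nonzero polynomial identity. -/
def IsPIAlgebra (K : Type*) [Field K] (R : Type*) [Ring R] [Algebra K R] : Prop :=
  ∃ f ∈ identitiesOf K R, f ≠ 0

/-- The space `P_n` of multilinear polynomials of degree `n`: the span of the monomials
`x_{σ(1)} ⋯ x_{σ(n)}`, `σ ∈ S_n` (the variables `x_1, …, x_n` carry the indices `0, …, n - 1`). -/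
def multilinearPolys (K : Type*) [Field K] (n : ℕ) : Submodule K (FreeAlgebra K ℕ) :=
  Submodule.span K (Set.range fun σ : Equiv.Perm (Fin n) =>
    (List.ofFn fun i : Fin n => FreeAlgebra.ι K ((σ i : Fin n) : ℕ)).prod)

/-- The codimension `c_n(R) = dim (P_n / (P_n ∩ T(R)))`; the space `P_n` has finite dimension. -/
noncomputable def codimension (K : Type*) [Field K] (R : Type*) [Ring R] [Algebra K R] (n : ℕ) : ℕ :=
  Module.finrank K
    (multilinearPolys K n ⧸ (identitiesOf K R).submoduleOf (multilinearPolys K n))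

/-- The codimension series `c(R, t) = ∑ c_n(R) t ^ n` in `ℂ[[t]]`. -/
noncomputable def codimensionSeries (K : Type*) [Field K] (R : Type*) [Ring R] [Algebra K R] :
    PowerSeries ℂ :=
  PowerSeries.mk fun n => (codimension K R n : ℂ)

open scoped RatFunc in
/-- A formal power series over `ℂ` is rational if, inside the field `ℂ((t))` of Laurent series, it
belongs to the subfield `ℂ(t)` of rational functions. -/
def IsRationalSeries (a : PowerSeries ℂ) : Prop :=
  ∃ r : RatFunc ℂ, algebraMap (RatFunc ℂ) (LaurentSeries ℂ) r = (a : LaurentSeries ℂ)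

open scoped RatFunc in
/-- A formal power series over `ℂ` is algebraic if, as an element of the field `ℂ((t))` of Laurent
series, it is algebraic over the field `ℂ(t)` of rational functions. -/
def IsAlgebraicSeries (a : PowerSeries ℂ) : Prop :=
  IsAlgebraic (RatFunc ℂ) (a : LaurentSeries ℂ)

/-! Let d_n be the dimension of the multilinear part of a T-ideal in n letters, so that c_n = n! -
d_n. T-ideals are multihomogeneous (`IsTIdeal.proj_mem`), hence the multilinear part of T₁T₂ in the
letters M is the sum, over S ⊆ M, of the products of the part of T₁ in S and the part of T₂ in M \
S. These products overlap. To obtain a direct sum, choose in the part of T₁ in S a complement U_S of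
the elements obtained from lower degree by appending a letter (`decomposables`). The U_S act as free
generators of T₁ as a right ideal, and the part of T₁T₂ in M is the direct sum of the products of
U_S with the part of T₂ in M \ S (`finrank_mul_inf_component`). Since dim U_S = d_n - n d_{n-1} for
n = |S|, the exponential generating functions satisfy D = (1 - t) D₁ D₂, which for codimensions
reads E = E₁ + E₂ - (1 - t) E₁ E₂ (`codimensionSeries_eq`).

It remains to see that the Laplace transform of E₁ E₂ is rational or algebraic
(`IsConvolutionClosed.laplace_mul_mem`). The rational series c(R₁, t) is a combination of terms t^m
/ (1 - αt)^(m+1), with Borel transforms e^(αt) t^m / m!. Under the Laplace transform, multiplication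
by t becomes f ↦ t (t f)', and multiplication by e^(αt) becomes f ↦ f(t / (1 - αt)) / (1 - αt).
Rational series and algebraic series are both stable under these operations. -/

/-! ### Rationality and algebraicity expressed over `ℂ[X]`. -/

open Polynomial in
theorem PowerSeries.algebraMap_polynomial_eq_coe (p : ℂ[X]) :
    algebraMap ℂ[X] (PowerSeries ℂ) p = (p : PowerSeries ℂ) := by
  simp [PowerSeries.algebraMap_apply']

open Polynomial in
theorem RatFunc.algebraMap_laurentSeries_algebraMap (p : ℂ[X]) :
    algebraMap (RatFunc ℂ) (LaurentSeries ℂ) (algebraMap ℂ[X] (RatFunc ℂ) p) =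
      HahnSeries.ofPowerSeries ℤ ℂ (p : PowerSeries ℂ) :=
  (RatFunc.coe_coe p).symm

open Polynomial in
theorem isRationalSeries_iff {a : PowerSeries ℂ} :
    IsRationalSeries a ↔ ∃ q : ℂ[X], q ≠ 0 ∧ ∃ p : ℂ[X], (q : PowerSeries ℂ) * a = p := by
  constructor
  · rintro ⟨r, hr⟩
    refine ⟨r.denom, r.denom_ne_zero, r.num, ?_⟩
    apply HahnSeries.ofPowerSeries_injective (Γ := ℤ) (R := ℂ)
    have h0 : algebraMap ℂ[X] (RatFunc ℂ) r.denom ≠ 0 := by simpa using r.denom_ne_zero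
    rw [map_mul, ← hr, ← RatFunc.algebraMap_laurentSeries_algebraMap,
      ← RatFunc.algebraMap_laurentSeries_algebraMap, ← map_mul]
    congr 1
    rw [mul_comm]
    exact ((div_eq_iff h0).1 (RatFunc.num_div_denom r)).symm
  · rintro ⟨q, hq, p, h⟩
    refine ⟨algebraMap _ _ p / algebraMap _ _ q, ?_⟩
    have h0 : algebraMap ℂ[X] (RatFunc ℂ) q ≠ 0 := by simpa using hq
    rw [map_div₀, div_eq_iff (by simpa using h0)]
    rw [RatFunc.algebraMap_laurentSeries_algebraMap, RatFunc.algebraMap_laurentSeries_algebraMap,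
      ← h, map_mul, mul_comm]

open Polynomial RatFunc in
theorem isAlgebraicSeries_iff {a : PowerSeries ℂ} :
    IsAlgebraicSeries a ↔ IsAlgebraic ℂ[X] a := by
  have : IsScalarTower ℂ[X] (PowerSeries ℂ) (LaurentSeries ℂ) :=
    IsScalarTower.of_algebraMap_eq fun p => by
      rw [IsScalarTower.algebraMap_apply ℂ[X] (RatFunc ℂ) (LaurentSeries ℂ),
        RatFunc.algebraMap_laurentSeries_algebraMap, PowerSeries.algebraMap_polynomial_eq_coe]
      rfl
  unfold IsAlgebraicSeries
  rw [← IsFractionRing.isAlgebraic_iff ℂ[X] (RatFunc ℂ)]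
  exact isAlgebraic_algebraMap_iff (HahnSeries.ofPowerSeries_injective (Γ := ℤ) (R := ℂ))

/-! ### Closure properties of rational and of algebraic series. -/

/-- The rational power series form a `ℂ[X]`-subalgebra. -/
noncomputable def rationalSeries : Subalgebra (Polynomial ℂ) (PowerSeries ℂ) where
  carrier := {a | ∃ q : Polynomial ℂ, q ≠ 0 ∧ ∃ p : Polynomial ℂ, (q : PowerSeries ℂ) * a = p}
  mul_mem' := by
    rintro a b ⟨q, hq, p, h⟩ ⟨q', hq', p', h'⟩
    refine ⟨q * q', mul_ne_zero hq hq', p * p', ?_⟩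
    push_cast
    rw [← h, ← h']
    ring
  add_mem' := by
    rintro a b ⟨q, hq, p, h⟩ ⟨q', hq', p', h'⟩
    refine ⟨q * q', mul_ne_zero hq hq', p * q' + p' * q, ?_⟩
    push_cast
    rw [← h, ← h']
    ring
  algebraMap_mem' p := ⟨1, one_ne_zero, p, by
    simp [PowerSeries.algebraMap_polynomial_eq_coe]⟩

theorem Polynomial.coe_powerSeries_ne_zero {q : Polynomial ℂ} (hq : q ≠ 0) :
    (q : PowerSeries ℂ) ≠ 0 := by
  simpa using hq

theorem mem_rationalSeries_of_mul_mem {u v : PowerSeries ℂ} (hu : u ∈ rationalSeries)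
    (h0 : u ≠ 0) (huv : u * v ∈ rationalSeries) : v ∈ rationalSeries := by
  obtain ⟨q, hq, p, h⟩ := hu
  obtain ⟨q', hq', p', h'⟩ := huv
  have hp : p ≠ 0 := by
    rintro rfl
    simp [hq, h0] at h
  refine ⟨q' * p, mul_ne_zero hq' hp, q * p', ?_⟩
  push_cast
  rw [← h, ← h']
  ring

/-- A class of power series that is closed under the operations needed to form binomial
convolutions with rational power series. -/
structure IsConvolutionClosed (B : Subalgebra (Polynomial ℂ) (PowerSeries ℂ)) : Prop where
  mem_of_mul_mem : ∀ {u v}, u ∈ B → u ≠ 0 → u * v ∈ B → v ∈ B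
  derivative_mem : ∀ {a}, a ∈ B → PowerSeries.derivative ℂ a ∈ B
  subst_mem : ∀ {u a}, PowerSeries.HasSubst u → u ≠ 0 → u ∈ B → a ∈ B → PowerSeries.subst u a ∈ B

theorem Polynomial.aeval_mem_of_mem (B : Subalgebra (Polynomial ℂ) (PowerSeries ℂ))
    {u : PowerSeries ℂ} (hu : u ∈ B) (p : Polynomial ℂ) : Polynomial.aeval u p ∈ B := by
  induction p using Polynomial.induction_on' with
  | add p q hp hq => rw [map_add]; exact B.add_mem hp hq
  | monomial n c =>
    rw [Polynomial.aeval_monomial]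
    refine B.mul_mem ?_ (B.pow_mem hu n)
    have := B.algebraMap_mem (Polynomial.C c)
    simpa [PowerSeries.algebraMap_polynomial_eq_coe] using this

theorem PowerSeries.subst_coe_ne_zero {u : PowerSeries ℂ} (hu : PowerSeries.HasSubst u)
    (h0 : u ≠ 0) {q : Polynomial ℂ} (hq : q ≠ 0) : PowerSeries.subst u (q : PowerSeries ℂ) ≠ 0 := by
  have hc : PowerSeries.constantCoeff u = 0 := by
    have : IsNilpotent (PowerSeries.constantCoeff u) := hu
    simpa using this
  -- Write q = X^k q' with q'(0) ≠ 0: then q(u) = u^k q'(u), and q'(u) has constant term q'(0)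
  -- because u(0) = 0.
  obtain ⟨q', hq', hdvd⟩ := Polynomial.exists_eq_pow_rootMultiplicity_mul_and_not_dvd q hq 0
  rw [PowerSeries.subst_coe hu, hq', map_mul, map_pow, map_sub, Polynomial.aeval_X, map_zero,
    map_zero, sub_zero]
  refine mul_ne_zero (pow_ne_zero _ h0) fun h => hdvd ?_
  rw [Polynomial.dvd_iff_isRoot]
  have hid : (PowerSeries.constantCoeff (R := ℂ)).comp (algebraMap ℂ (PowerSeries ℂ)) =
      RingHom.id ℂ := RingHom.ext fun c => by simp
  have h1 : Polynomial.eval₂ ((PowerSeries.constantCoeff (R := ℂ)).comp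
      (algebraMap ℂ (PowerSeries ℂ))) (PowerSeries.constantCoeff u) q' = 0 := by
    rw [← Polynomial.hom_eval₂]
    exact (congrArg _ h).trans (map_zero _)
  rwa [hid, hc] at h1

theorem rationalSeries_isConvolutionClosed : IsConvolutionClosed rationalSeries where
  mem_of_mul_mem := mem_rationalSeries_of_mul_mem
  derivative_mem := by
    rintro a ⟨q, hq, p, h⟩
    have h' := congrArg (PowerSeries.derivative ℂ) h
    rw [Derivation.leibniz, PowerSeries.derivative_coe, PowerSeries.derivative_coe] at h'
    refine ⟨q ^ 2, pow_ne_zero _ hq, q * Polynomial.derivative p - p * Polynomial.derivative q, ?_⟩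
    simp only [smul_eq_mul] at h'
    push_cast
    linear_combination (q : PowerSeries ℂ) * h' - (Polynomial.derivative q : PowerSeries ℂ) * h
  subst_mem := by
    rintro u a hu h0 huB ⟨q, hq, p, h⟩
    have h' := congrArg (PowerSeries.subst u) h
    rw [PowerSeries.subst_mul hu] at h'
    refine mem_rationalSeries_of_mul_mem ?_ (PowerSeries.subst_coe_ne_zero hu h0 hq) (h' ▸ ?_)
    all_goals
      rw [PowerSeries.subst_coe hu]
      exact Polynomial.aeval_mem_of_mem _ huB _

/-- The algebraic power series form a `ℂ[X]`-subalgebra. -/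
noncomputable abbrev algebraicSeries : Subalgebra (Polynomial ℂ) (PowerSeries ℂ) :=
  Subalgebra.algebraicClosure (Polynomial ℂ) (PowerSeries ℂ)

theorem mem_algebraicSeries_of_mul_mem {u v : PowerSeries ℂ} (hu : u ∈ algebraicSeries)
    (h0 : u ≠ 0) (huv : u * v ∈ algebraicSeries) : v ∈ algebraicSeries :=
  IsAlgebraic.of_mul (mem_nonZeroDivisors_of_ne_zero h0) hu huv

theorem aeval_mem_subalgebra {B : Subalgebra (Polynomial ℂ) (PowerSeries ℂ)} {a : PowerSeries ℂ}
    (ha : a ∈ B) (P : Polynomial (Polynomial ℂ)) : Polynomial.aeval a P ∈ B :=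
  Algebra.adjoin_le (Set.singleton_subset_iff.2 ha) (Polynomial.aeval_mem_adjoin_singleton _ _)

/-- By the chain rule, the difference is the value at `a` of `P` with its coefficients
differentiated. -/
theorem derivative_aeval_sub_mem {B : Subalgebra (Polynomial ℂ) (PowerSeries ℂ)}
    {a : PowerSeries ℂ} (ha : a ∈ B) (P : Polynomial (Polynomial ℂ)) :
    PowerSeries.derivative ℂ (Polynomial.aeval a P) -
      Polynomial.aeval a (Polynomial.derivative P) * PowerSeries.derivative ℂ a ∈ B := by
  induction P using Polynomial.induction_on' with
  | add p q hp hq =>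
    convert B.add_mem hp hq using 1
    simp only [map_add]
    ring
  | monomial n c =>
    have key : PowerSeries.derivative ℂ (Polynomial.aeval a (Polynomial.monomial n c)) -
        Polynomial.aeval a (Polynomial.derivative (Polynomial.monomial n c)) *
          PowerSeries.derivative ℂ a =
        algebraMap _ _ (Polynomial.derivative c) * a ^ n := by
      rw [Polynomial.derivative_monomial, Polynomial.aeval_monomial, Polynomial.aeval_monomial,
        Derivation.leibniz, Derivation.leibniz_pow, PowerSeries.algebraMap_polynomial_eq_coe,
        PowerSeries.algebraMap_polynomial_eq_coe, PowerSeries.algebraMap_polynomial_eq_coe,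
        PowerSeries.derivative_coe]
      simp only [smul_eq_mul, nsmul_eq_mul, Polynomial.coe_mul]
      have : ((n : Polynomial ℂ) : PowerSeries ℂ) = (n : PowerSeries ℂ) :=
        map_natCast Polynomial.coeToPowerSeries.ringHom n
      rw [this]
      ring
    rw [key]
    exact B.mul_mem (B.algebraMap_mem _) (B.pow_mem ha n)

/-- Differentiating P(a) = 0 expresses P'(a) a' through `a`, and one divides by P'(a). -/
theorem derivative_mem_algebraicSeries {a : PowerSeries ℂ} (ha : a ∈ algebraicSeries) :
    PowerSeries.derivative ℂ a ∈ algebraicSeries := by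
  obtain ⟨P, hP, h⟩ := ha
  induction hn : P.natDegree using Nat.strong_induction_on generalizing P with
  | _ n ih =>
  -- If P'(a) = 0, then P' is a nonzero annihilator of smaller degree.
  by_cases hd : Polynomial.aeval a (Polynomial.derivative P) = 0
  · have hP0 : P.natDegree ≠ 0 := by
      intro h0
      rw [Polynomial.eq_C_of_natDegree_eq_zero h0, Polynomial.aeval_C,
        PowerSeries.algebraMap_polynomial_eq_coe] at h
      refine Polynomial.coe_powerSeries_ne_zero ?_ h
      rintro h1
      apply hP
      rw [Polynomial.eq_C_of_natDegree_eq_zero h0, h1, map_zero]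
    refine ih _ (hn ▸ Polynomial.natDegree_derivative_lt hP0) _ (fun h1 => hP0 ?_) hd rfl
    exact Polynomial.derivative_eq_zero.1 h1
  · have ha : a ∈ algebraicSeries := ⟨P, hP, h⟩
    refine mem_algebraicSeries_of_mul_mem (aeval_mem_subalgebra ha _) hd ?_
    have := derivative_aeval_sub_mem ha P
    rwa [h, map_zero, zero_sub, neg_mem_iff] at this

/-- Substituting u in P(t, a) = 0 gives P(u, a(u)) = 0, whose coefficients are algebraic series. The
equation stays nontrivial because p ↦ p(u) is injective, and algebraicity is transitive. -/
theorem subst_mem_algebraicSeries {u a : PowerSeries ℂ} (hu : PowerSeries.HasSubst u)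
    (h0 : u ≠ 0) (huB : u ∈ algebraicSeries) (ha : a ∈ algebraicSeries) :
    PowerSeries.subst u a ∈ algebraicSeries := by
  obtain ⟨P, hP, h⟩ := ha
  have hcoe : ∀ p : Polynomial ℂ, PowerSeries.substAlgHom (R := ℂ) hu (p : PowerSeries ℂ) =
      Polynomial.aeval u p := fun p => PowerSeries.substAlgHom_coe hu p
  let g : Polynomial ℂ →+* algebraicSeries :=
    { toFun := fun p => ⟨Polynomial.aeval u p, Polynomial.aeval_mem_of_mem _ huB p⟩
      map_one' := by ext1; simp
      map_mul' := fun p q => by ext1; simp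
      map_zero' := by ext1; simp
      map_add' := fun p q => by ext1; simp }
  have hg : Function.Injective g := by
    rw [injective_iff_map_eq_zero]
    intro p hp
    by_contra hp0
    refine PowerSeries.subst_coe_ne_zero hu h0 hp0 ?_
    rw [PowerSeries.subst_coe hu]
    exact congrArg Subtype.val hp
  have : IsAlgebraic algebraicSeries (PowerSeries.subst u a) := by
    refine ⟨P.map g, (Polynomial.map_ne_zero_iff hg).2 hP, ?_⟩
    have h2 := congrArg (PowerSeries.substAlgHom (R := ℂ) hu) h
    rw [map_zero] at h2
    rw [← h2, Polynomial.aeval_def, Polynomial.aeval_def, Polynomial.eval₂_map,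
      ← PowerSeries.coe_substAlgHom hu]
    refine Eq.trans ?_ (Polynomial.hom_eval₂ P (algebraMap (Polynomial ℂ) (PowerSeries ℂ))
      (PowerSeries.substAlgHom (R := ℂ) hu : PowerSeries ℂ →+* PowerSeries ℂ) a).symm
    congr 1
    refine RingHom.ext fun p => ?_
    rw [RingHom.comp_apply, RingHom.comp_apply, PowerSeries.algebraMap_polynomial_eq_coe]
    exact (hcoe p).symm
  have : Algebra.IsAlgebraic (Polynomial ℂ) algebraicSeries :=
    (Subalgebra.isAlgebraic_iff _).mp fun _ => id
  exact IsAlgebraic.restrictScalars _ ‹IsAlgebraic algebraicSeries _›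

theorem algebraicSeries_isConvolutionClosed : IsConvolutionClosed algebraicSeries where
  mem_of_mul_mem := mem_algebraicSeries_of_mul_mem
  derivative_mem := derivative_mem_algebraicSeries
  subst_mem := subst_mem_algebraicSeries

/-! ### Formal Laplace and Borel transforms. -/

open PowerSeries in
/-- The formal Laplace transform, multiplying the `n`-th coefficient by `n!`. -/
noncomputable def PowerSeries.laplace : ℂ⟦X⟧ →ₗ[ℂ] ℂ⟦X⟧ where
  toFun f := mk fun n => (n.factorial : ℂ) * coeff n f
  map_add' f g := by ext n; simp [mul_add]
  map_smul' c f := by ext n; simp; ring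

open PowerSeries in
/-- The formal Borel transform, dividing the `n`-th coefficient by `n!`. -/
noncomputable def PowerSeries.borel : ℂ⟦X⟧ →ₗ[ℂ] ℂ⟦X⟧ where
  toFun f := mk fun n => (n.factorial : ℂ)⁻¹ * coeff n f
  map_add' f g := by ext n; simp [mul_add]
  map_smul' c f := by ext n; simp; ring

namespace PowerSeries

@[simp] theorem coeff_laplace (f : ℂ⟦X⟧) (n : ℕ) :
    coeff n (laplace f) = (n.factorial : ℂ) * coeff n f := by simp [laplace]

@[simp] theorem coeff_borel (f : ℂ⟦X⟧) (n : ℕ) :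
    coeff n (borel f) = (n.factorial : ℂ)⁻¹ * coeff n f := by simp [borel]

theorem laplace_borel (f : ℂ⟦X⟧) : laplace (borel f) = f := by
  ext n
  simp [Nat.factorial_ne_zero]

theorem borel_laplace (f : ℂ⟦X⟧) : borel (laplace f) = f := by
  ext n
  simp [Nat.factorial_ne_zero]

theorem laplace_X_mul (f : ℂ⟦X⟧) : laplace (X * f) = X * derivative ℂ (X * laplace f) := by
  ext n
  cases n with
  | zero => simp
  | succ n =>
    rw [coeff_laplace, coeff_succ_X_mul, coeff_succ_X_mul, coeff_derivative, coeff_succ_X_mul,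
      coeff_laplace, Nat.factorial_succ]
    push_cast
    ring

/-- The geometric series `1 / (1 - α X)`. -/
noncomputable def geom (α : ℂ) : ℂ⟦X⟧ := mk fun n => α ^ n

/-- The exponential series `exp (α X)`. -/
noncomputable def expo (α : ℂ) : ℂ⟦X⟧ := mk fun n => (n.factorial : ℂ)⁻¹ * α ^ n

theorem geom_eq (α : ℂ) : geom α = 1 + C α * X * geom α := by
  ext n
  cases n with
  | zero => simp [geom]
  | succ n =>
    rw [map_add, mul_assoc, coeff_C_mul, coeff_succ_X_mul]
    simp [geom, coeff_one, pow_succ']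

theorem geom_zero : geom 0 = 1 := by
  rw [geom_eq]; simp

theorem geom_ne_zero (α : ℂ) : geom α ≠ 0 := by
  intro h
  have := congrArg (coeff 0) h
  simp [geom] at this

theorem coeff_geom_pow (α : ℂ) (m n : ℕ) :
    coeff n (geom α ^ (m + 1)) = (Nat.choose (m + n) m : ℂ) * α ^ n := by
  have h : geom α = rescale α (mk 1) := by
    ext n
    simp [geom, coeff_rescale]
  rw [h, ← map_pow, mk_one_pow_eq_mk_choose_add, coeff_rescale]
  simp [mul_comm]

/-- In degree m + k both sides have coefficient (m+k)!/k! · α^k. -/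
theorem laplace_expo_mul_X_pow (α : ℂ) (m : ℕ) :
    laplace (expo α * X ^ m) = (m.factorial : ℂ) • (X ^ m * geom α ^ (m + 1)) := by
  ext n
  rw [coeff_laplace, coeff_mul_X_pow', coeff_smul, coeff_X_pow_mul']
  split_ifs with h
  · obtain ⟨k, rfl⟩ := Nat.exists_eq_add_of_le h
    rw [Nat.add_sub_cancel_left, coeff_geom_pow, expo, coeff_mk]
    have := Nat.add_choose_mul_factorial_mul_factorial m k
    have hk : (k.factorial : ℂ) ≠ 0 := by exact_mod_cast k.factorial_ne_zero
    have h2 : (Nat.choose (m + k) m : ℂ) * m.factorial * k.factorial = (m + k).factorial := by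
      rw [Nat.choose_symm_add]
      exact_mod_cast this
    rw [← h2, smul_eq_mul]
    field_simp
  · simp

/-- The divisibility hypotheses say that both maps are X-adically continuous, and polynomials are
dense. -/
theorem linearMap_ext_of_X_pow_dvd {A B : ℂ⟦X⟧ →ₗ[ℂ] ℂ⟦X⟧}
    (hA : ∀ N b, X ^ N ∣ A (X ^ N * b)) (hB : ∀ N b, X ^ N ∣ B (X ^ N * b))
    (h : ∀ j, A (X ^ j) = B (X ^ j)) : A = B := by
  have hp : ∀ p : Polynomial ℂ, A p = B p := by
    intro p
    induction p using Polynomial.induction_on' with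
    | add p q hp hq => rw [Polynomial.coe_add, map_add, map_add, hp, hq]
    | monomial n c =>
      have : ((Polynomial.monomial n c : Polynomial ℂ) : ℂ⟦X⟧) = c • X ^ n := by
        rw [Polynomial.coe_monomial]
        ext m
        simp [coeff_monomial, coeff_X_pow]
      rw [this, map_smul, map_smul, h]
  ext b n
  have hb := eq_X_pow_mul_shift_add_trunc (n + 1) b
  rw [hb, map_add, map_add, map_add, map_add, hp,
    X_pow_dvd_iff.1 (hA (n + 1) _) n n.lt_succ_self,
    X_pow_dvd_iff.1 (hB (n + 1) _) n n.lt_succ_self]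

theorem hasSubst_X_mul_geom (α : ℂ) : HasSubst (X * geom α) :=
  HasSubst.of_constantCoeff_zero' (by simp)

/-- Multiplication of the Borel transform by `exp (α X)` is a substitution. -/
theorem laplace_expo_mul_borel (α : ℂ) (b : ℂ⟦X⟧) :
    laplace (expo α * borel b) = geom α * subst (X * geom α) b := by
  let A : ℂ⟦X⟧ →ₗ[ℂ] ℂ⟦X⟧ := laplace ∘ₗ LinearMap.mulLeft ℂ (expo α) ∘ₗ borel
  let B : ℂ⟦X⟧ →ₗ[ℂ] ℂ⟦X⟧ := LinearMap.mulLeft ℂ (geom α) ∘ₗ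
    (substAlgHom (R := ℂ) (hasSubst_X_mul_geom α)).toLinearMap
  have hB : ∀ b, B b = geom α * subst (X * geom α) b := fun b => by
    simp only [B, LinearMap.comp_apply, AlgHom.toLinearMap_apply, coe_substAlgHom]
    rfl
  have key : A = B := by
    refine linearMap_ext_of_X_pow_dvd (fun N b => ?_) (fun N b => ?_) fun j => ?_
    · have h1 : X ^ N ∣ borel (X ^ N * b) := X_pow_dvd_iff.2 fun m hm => by
        rw [coeff_borel, X_pow_dvd_iff.1 (dvd_mul_right _ _) m hm, mul_zero]
      refine X_pow_dvd_iff.2 fun m hm => ?_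
      change coeff m (laplace (expo α * borel (X ^ N * b))) = 0
      rw [coeff_laplace, X_pow_dvd_iff.1 (h1.mul_left _) m hm, mul_zero]
    · rw [hB, subst_mul (hasSubst_X_mul_geom α), subst_pow (hasSubst_X_mul_geom α),
        subst_X (hasSubst_X_mul_geom α), mul_pow]
      exact ⟨geom α * (geom α ^ N * subst (X * geom α) b), by ring⟩
    · rw [hB, subst_pow (hasSubst_X_mul_geom α), subst_X (hasSubst_X_mul_geom α)]
      have h1 : borel (X ^ j) = (j.factorial : ℂ)⁻¹ • X ^ j := by
        ext n
        simp only [coeff_borel, coeff_smul, coeff_X_pow, smul_eq_mul]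
        split_ifs with h
        · rw [h]
        · simp
      change laplace (expo α * borel (X ^ j)) = _
      rw [h1, mul_smul_comm, map_smul, laplace_expo_mul_X_pow, smul_smul,
        inv_mul_cancel₀ (by exact_mod_cast j.factorial_ne_zero), one_smul]
      ring
  rw [← hB, ← key]
  rfl

end PowerSeries

/-! ### Partial fractions. -/

namespace PowerSeries

/-- The span of the series `X ^ m / (1 - α X) ^ (m + 1)`. -/
noncomputable def partialFractions : Submodule ℂ ℂ⟦X⟧ :=
  Submodule.span ℂ (Set.range fun p : ℂ × ℕ => X ^ p.2 * geom p.1 ^ (p.2 + 1))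

theorem X_pow_mul_geom_pow_mem (α : ℂ) (m : ℕ) :
    X ^ m * geom α ^ (m + 1) ∈ partialFractions :=
  Submodule.subset_span ⟨(α, m), rfl⟩

/-- The parameter α = 0 provides the polynomials. -/
theorem X_pow_mem_partialFractions (m : ℕ) : X ^ m ∈ partialFractions := by
  simpa [geom_zero] using X_pow_mul_geom_pow_mem 0 m

theorem map_mem_partialFractions (f : ℂ⟦X⟧ →ₗ[ℂ] ℂ⟦X⟧)
    (h : ∀ α m, f (X ^ m * geom α ^ (m + 1)) ∈ partialFractions) {a : ℂ⟦X⟧}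
    (ha : a ∈ partialFractions) : f a ∈ partialFractions := by
  have : partialFractions ≤ partialFractions.comap f :=
    Submodule.span_le.2 (by rintro _ ⟨⟨α, m⟩, rfl⟩; exact h α m)
  exact this ha

theorem X_mul_basic_mem (α : ℂ) (m : ℕ) :
    X * (X ^ m * geom α ^ (m + 1)) ∈ partialFractions := by
  rcases eq_or_ne α 0 with rfl | hα
  · simpa [geom_zero, pow_succ'] using X_pow_mem_partialFractions (m + 1)
  -- This is αX · geom α = geom α - 1. The remaining term X^m geom^m is X times the basic series for
  -- m - 1, which permits induction.
  have key : ∀ m, X * (X ^ m * geom α ^ (m + 1)) =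
      α⁻¹ • (X ^ m * geom α ^ (m + 1) - X ^ m * geom α ^ m) := fun m => by
    have hC : C α⁻¹ * C α = (1 : ℂ⟦X⟧) := by rw [← map_mul, inv_mul_cancel₀ hα, map_one]
    rw [smul_eq_C_mul]
    linear_combination (-(X ^ m * geom α ^ m) * C α⁻¹) * geom_eq α -
      (X * X ^ m * geom α ^ m * geom α) * hC
  rw [key]
  refine Submodule.smul_mem _ _ (Submodule.sub_mem _ (X_pow_mul_geom_pow_mem α m) ?_)
  induction m with
  | zero => simpa using X_pow_mem_partialFractions 0
  | succ m ih =>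
    rw [pow_succ', mul_assoc, key]
    exact Submodule.smul_mem _ _ (Submodule.sub_mem _ (X_pow_mul_geom_pow_mem α m) ih)

theorem X_mul_mem_partialFractions {a : ℂ⟦X⟧} (ha : a ∈ partialFractions) :
    X * a ∈ partialFractions :=
  map_mem_partialFractions (LinearMap.mulLeft ℂ X) X_mul_basic_mem ha

theorem geom_mul_basic_mem (β α : ℂ) (m : ℕ) :
    geom β * (X ^ m * geom α ^ (m + 1)) ∈ partialFractions := by
  rcases eq_or_ne α β with rfl | hαβ
  · have key : geom α * (X ^ m * geom α ^ (m + 1)) =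
        X ^ m * geom α ^ (m + 1) + α • (X ^ (m + 1) * geom α ^ (m + 1 + 1)) := by
      rw [smul_eq_C_mul]
      linear_combination (X ^ m * geom α ^ (m + 1)) * geom_eq α
    rw [key]
    exact Submodule.add_mem _ (X_pow_mul_geom_pow_mem α m)
      (Submodule.smul_mem _ _ (X_pow_mul_geom_pow_mem α (m + 1)))
  · have hC : C (α - β)⁻¹ * (C α - C β) = (1 : ℂ⟦X⟧) := by
      rw [← map_sub, ← map_mul, inv_mul_cancel₀ (sub_ne_zero.2 hαβ), map_one]
    -- The classical splitting of 1 / ((1 - αX)(1 - βX)) for α ≠ β.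
    have h1 : geom β * geom α = (α - β)⁻¹ • (α • geom α - β • geom β) := by
      rw [smul_eq_C_mul, smul_eq_C_mul, smul_eq_C_mul]
      have h2 : (C α - C β) * (geom β * geom α) = C α * geom α - C β * geom β := by
        linear_combination (C α * geom α) * geom_eq β - C β * geom β * geom_eq α
      linear_combination (-(geom β * geom α)) * hC + C (α - β)⁻¹ * h2
    induction m with
    | zero =>
      rw [pow_zero, one_mul, zero_add, pow_one, h1]
      refine Submodule.smul_mem _ _ (Submodule.sub_mem _ (Submodule.smul_mem _ _ ?_)
        (Submodule.smul_mem _ _ ?_))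
      · simpa using X_pow_mul_geom_pow_mem α 0
      · simpa using X_pow_mul_geom_pow_mem β 0
    | succ m ih =>
      have h3 : geom β * (X ^ (m + 1) * geom α ^ (m + 1 + 1)) =
          (α - β)⁻¹ • (α • (X ^ (m + 1) * geom α ^ (m + 1 + 1)) -
            β • (X * (geom β * (X ^ m * geom α ^ (m + 1))))) := by
        rw [smul_eq_C_mul, smul_eq_C_mul, smul_eq_C_mul] at h1 ⊢
        linear_combination (X ^ (m + 1) * geom α ^ (m + 1)) * h1
      rw [h3]
      exact Submodule.smul_mem _ _ (Submodule.sub_mem _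
        (Submodule.smul_mem _ _ (X_pow_mul_geom_pow_mem α (m + 1)))
        (Submodule.smul_mem _ _ (X_mul_mem_partialFractions ih)))

theorem geom_mul_mem_partialFractions (β : ℂ) {a : ℂ⟦X⟧} (ha : a ∈ partialFractions) :
    geom β * a ∈ partialFractions :=
  map_mem_partialFractions (LinearMap.mulLeft ℂ (geom β)) (geom_mul_basic_mem β) ha

/-- The shift `a ↦ (a - a(0)) / X`. -/
noncomputable def shift : ℂ⟦X⟧ →ₗ[ℂ] ℂ⟦X⟧ where
  toFun f := mk fun n => coeff (n + 1) f
  map_add' f g := by ext n; simp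
  map_smul' c f := by ext n; simp

theorem shift_X_mul (f : ℂ⟦X⟧) : shift (X * f) = f := by
  ext n
  simp [shift, coeff_succ_X_mul]

theorem mem_partialFractions_of_X_mul_mem {a : ℂ⟦X⟧} (ha : X * a ∈ partialFractions) :
    a ∈ partialFractions := by
  rw [← shift_X_mul a]
  refine map_mem_partialFractions shift (fun α m => ?_) ha
  cases m with
  | zero =>
    have h1 : shift (geom α) = α • geom α := by
      ext n
      simp [shift, geom, pow_succ']
    simpa [h1] using Submodule.smul_mem _ α (X_pow_mul_geom_pow_mem α 0)
  | succ m =>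
    have : X ^ (m + 1) * geom α ^ (m + 1 + 1) = X * (geom α * (X ^ m * geom α ^ (m + 1))) := by
      ring
    rw [this, shift_X_mul]
    exact geom_mul_basic_mem α α m

theorem mem_partialFractions_of_X_sub_C_mul_mem (r : ℂ) {a : ℂ⟦X⟧}
    (ha : (X - C r) * a ∈ partialFractions) : a ∈ partialFractions := by
  rcases eq_or_ne r 0 with rfl | hr
  · exact mem_partialFractions_of_X_mul_mem (by simpa using ha)
  · have hC : C r⁻¹ * C r = (1 : ℂ⟦X⟧) := by rw [← map_mul, inv_mul_cancel₀ hr, map_one]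
    -- Since X - r = -r (1 - X/r), dividing by X - r is multiplying by -r⁻¹ · geom r⁻¹.
    have : a = -r⁻¹ • (geom r⁻¹ * ((X - C r) * a)) := by
      rw [neg_smul, smul_eq_C_mul]
      have := geom_eq r⁻¹
      linear_combination (-a * geom r⁻¹) * hC - a * this
    rw [this]
    exact Submodule.smul_mem _ _ (geom_mul_mem_partialFractions _ ha)

/-- Over ℂ the polynomial splits, so its linear factors can be cancelled one at a time. -/
theorem mem_partialFractions_of_polynomial_mul_mem {q : Polynomial ℂ} (hq : q ≠ 0) {a : ℂ⟦X⟧}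
    (ha : (q : ℂ⟦X⟧) * a ∈ partialFractions) : a ∈ partialFractions := by
  induction hn : q.natDegree generalizing q with
  | zero =>
    rw [Polynomial.eq_C_of_natDegree_eq_zero hn, Polynomial.coe_C, ← smul_eq_C_mul] at ha
    refine (Submodule.smul_mem_iff _ fun h => hq ?_).1 ha
    rw [Polynomial.eq_C_of_natDegree_eq_zero hn, h, map_zero]
  | succ n ih =>
    obtain ⟨r, hr⟩ := IsAlgClosed.exists_root q (fun h => by
      rw [Polynomial.natDegree_eq_of_degree_eq_some (h.trans Nat.cast_zero.symm)] at hn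
      omega)
    obtain ⟨q', rfl⟩ := Polynomial.dvd_iff_isRoot.2 hr
    have hq' : q' ≠ 0 := right_ne_zero_of_mul hq
    refine ih hq' (mem_partialFractions_of_X_sub_C_mul_mem r ?_) ?_
    · simpa [mul_assoc] using ha
    · rw [Polynomial.natDegree_mul (Polynomial.X_sub_C_ne_zero r) hq',
        Polynomial.natDegree_X_sub_C] at hn
      omega

theorem polynomial_mem_partialFractions (p : Polynomial ℂ) : (p : ℂ⟦X⟧) ∈ partialFractions := by
  induction p using Polynomial.induction_on' with
  | add p q hp hq => rw [Polynomial.coe_add]; exact Submodule.add_mem _ hp hq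
  | monomial n c =>
    have : ((Polynomial.monomial n c : Polynomial ℂ) : ℂ⟦X⟧) = c • X ^ n := by
      rw [Polynomial.coe_monomial]
      ext m
      simp [coeff_monomial, coeff_X_pow]
    rw [this]
    exact Submodule.smul_mem _ _ (X_pow_mem_partialFractions n)

theorem mem_partialFractions_of_mem_rationalSeries {a : ℂ⟦X⟧} (ha : a ∈ rationalSeries) :
    a ∈ partialFractions := by
  obtain ⟨q, hq, p, h⟩ := ha
  exact mem_partialFractions_of_polynomial_mul_mem hq (h ▸ polynomial_mem_partialFractions p)

end PowerSeries

/-! ### Binomial convolution with a rational series. -/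

namespace IsConvolutionClosed

open PowerSeries

variable {B : Subalgebra (Polynomial ℂ) (PowerSeries ℂ)}

theorem X_mem (B : Subalgebra (Polynomial ℂ) (PowerSeries ℂ)) : (X : ℂ⟦X⟧) ∈ B := by
  simpa [algebraMap_polynomial_eq_coe] using B.algebraMap_mem Polynomial.X

theorem smul_mem (c : ℂ) {a : ℂ⟦X⟧} (ha : a ∈ B) : c • a ∈ B := by
  rw [smul_eq_C_mul]
  refine B.mul_mem ?_ ha
  simpa [algebraMap_polynomial_eq_coe] using B.algebraMap_mem (Polynomial.C c)

theorem geom_mem (hB : IsConvolutionClosed B) (α : ℂ) : geom α ∈ B := by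
  have h : (1 - α • X) * geom α = 1 := by
    rw [smul_eq_C_mul]
    linear_combination geom_eq α
  exact hB.mem_of_mul_mem (B.sub_mem B.one_mem (smul_mem α (X_mem B)))
    (left_ne_zero_of_mul (h ▸ one_ne_zero)) (by rw [h]; exact B.one_mem)

theorem laplace_X_pow_mul_mem (hB : IsConvolutionClosed B) (m : ℕ) {b : ℂ⟦X⟧} (hb : laplace b ∈ B) :
    laplace (X ^ m * b) ∈ B := by
  induction m with
  | zero => simpa using hb
  | succ m ih =>
    rw [pow_succ', mul_assoc, laplace_X_mul]
    exact B.mul_mem (X_mem B) (hB.derivative_mem (B.mul_mem (X_mem B) ih))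

theorem laplace_expo_mul_mem (hB : IsConvolutionClosed B) (α : ℂ) {b : ℂ⟦X⟧}
    (hb : laplace b ∈ B) : laplace (expo α * b) ∈ B := by
  rw [← borel_laplace b, laplace_expo_mul_borel]
  exact B.mul_mem (hB.geom_mem α) (hB.subst_mem (hasSubst_X_mul_geom α)
    (mul_ne_zero X_ne_zero (geom_ne_zero α)) (B.mul_mem (X_mem B) (hB.geom_mem α)) hb)

/-- Binomial convolutions with rational power series stay in the class. -/
theorem laplace_mul_mem (hB : IsConvolutionClosed B) {a b : ℂ⟦X⟧}
    (ha : laplace a ∈ rationalSeries) (hb : laplace b ∈ B) : laplace (a * b) ∈ B := by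
  have h := mem_partialFractions_of_mem_rationalSeries ha
  rw [← borel_laplace a]
  generalize laplace a = c at h
  clear ha
  induction h using Submodule.span_induction with
  | mem x hx =>
    obtain ⟨⟨α, m⟩, rfl⟩ := hx
    have h1 : X ^ m * geom α ^ (m + 1) =
        laplace ((m.factorial : ℂ)⁻¹ • (expo α * X ^ m)) := by
      rw [map_smul, laplace_expo_mul_X_pow, smul_smul,
        inv_mul_cancel₀ (by exact_mod_cast m.factorial_ne_zero), one_smul]
    simp only []
    rw [h1, borel_laplace, smul_mul_assoc, map_smul, mul_assoc]
    exact smul_mem _ (hB.laplace_expo_mul_mem α (hB.laplace_X_pow_mul_mem m hb))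
  | zero => rw [map_zero, zero_mul, map_zero]; exact B.zero_mem
  | add x y _ _ hx hy => rw [map_add, add_mul, map_add]; exact B.add_mem hx hy
  | smul c x _ hx => rw [map_smul, smul_mul_assoc, map_smul]; exact smul_mem c hx

end IsConvolutionClosed

/-! ### Words, multihomogeneous components and right quotients in the free algebra. -/

namespace FreeAlgebra

variable {K : Type*} [Field K]

/-- The monomial of the free algebra spelled by a word. -/
noncomputable def word (K : Type*) [Field K] (l : List ℕ) : FreeAlgebra K ℕ := (l.map (ι K)).prod

@[simp] theorem word_nil : word K [] = 1 := rfl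

theorem word_append (l l' : List ℕ) : word K (l ++ l') = word K l * word K l' := by
  simp [word]

theorem word_cons (i : ℕ) (l : List ℕ) : word K (i :: l) = ι K i * word K l := by
  simp [word]

/-- The words form a basis of the free algebra. -/
noncomputable def wordBasis (K : Type*) [Field K] : Module.Basis (List ℕ) K (FreeAlgebra K ℕ) :=
  (basisFreeMonoid K ℕ).reindex FreeMonoid.toList

@[simp] theorem wordBasis_apply (l : List ℕ) : wordBasis K l = word K l := by
  rw [wordBasis, Module.Basis.reindex_apply]
  have : ∀ w : FreeMonoid ℕ, basisFreeMonoid K ℕ w = word K w.toList := by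
    intro w
    rw [basisFreeMonoid, Module.Basis.map_apply]
    simp [equivMonoidAlgebraFreeMonoid, word, FreeMonoid.lift_apply]
  exact this _

theorem linearMap_ext_word {M : Type*} [AddCommGroup M] [Module K M]
    {f g : FreeAlgebra K ℕ →ₗ[K] M} (h : ∀ l, f (word K l) = g (word K l)) : f = g :=
  (wordBasis K).ext fun l => by simpa using h l

theorem map_mem_of_word {M : Type*} [AddCommGroup M] [Module K M] {Z : Submodule K M}
    {g : FreeAlgebra K ℕ →ₗ[K] M} (h : ∀ l, g (word K l) ∈ Z) (f : FreeAlgebra K ℕ) :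
    g f ∈ Z := by
  have : Submodule.span K (Set.range (wordBasis K)) ≤ Z.comap g :=
    Submodule.span_le.2 (by rintro _ ⟨l, rfl⟩; simpa using h l)
  exact this ((wordBasis K).mem_span f)

/-- The span of all words with a given multiset of letters. -/
noncomputable def component (K : Type*) [Field K] (m : Multiset ℕ) : Submodule K (FreeAlgebra K ℕ) :=
  Submodule.span K (word K '' {l | (l : Multiset ℕ) = m})

theorem word_mem_component (l : List ℕ) : word K l ∈ component K (l : Multiset ℕ) :=
  Submodule.subset_span ⟨l, rfl, rfl⟩

theorem component_le {m : Multiset ℕ} {Z : Submodule K (FreeAlgebra K ℕ)}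
    (h : ∀ l : List ℕ, (l : Multiset ℕ) = m → word K l ∈ Z) : component K m ≤ Z :=
  Submodule.span_le.2 (by rintro _ ⟨l, hl, rfl⟩; exact h l hl)

theorem mul_component_le {m : Multiset ℕ} {U Z : Submodule K (FreeAlgebra K ℕ)}
    (h : ∀ u ∈ U, ∀ l : List ℕ, (l : Multiset ℕ) = m → u * word K l ∈ Z) :
    U * component K m ≤ Z := by
  refine Submodule.mul_le.2 fun u hu v hv => ?_
  have : component K m ≤ Z.comap (LinearMap.mulLeft K u) :=
    component_le fun l hl => h u hu l hl
  exact this hv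

theorem component_mul_component_le (m m' : Multiset ℕ) :
    component K m * component K m' ≤ component K (m + m') := by
  refine mul_component_le fun u hu l hl => ?_
  have : component K m ≤ (component K (m + m')).comap (LinearMap.mulRight K (word K l)) := by
    refine component_le fun l' hl' => ?_
    rw [Submodule.mem_comap, LinearMap.mulRight_apply, ← word_append, ← hl, ← hl',
      Multiset.coe_add]
    exact word_mem_component _
  exact this hu

theorem finite_words (m : Multiset ℕ) : {l : List ℕ | (l : Multiset ℕ) = m}.Finite := by
  induction m using Quotient.inductionOn with
  | _ l₀ =>
    refine (List.finite_toSet l₀.permutations).subset fun l hl => ?_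
    simpa using hl

instance (m : Multiset ℕ) : FiniteDimensional K (component K m) :=
  FiniteDimensional.span_of_finite K ((finite_words m).image _)

/-- The projection onto a multihomogeneous component. -/
noncomputable def proj (K : Type*) [Field K] (m : Multiset ℕ) :
    FreeAlgebra K ℕ →ₗ[K] FreeAlgebra K ℕ :=
  (wordBasis K).constr K fun l => if (l : Multiset ℕ) = m then word K l else 0

theorem proj_word (m : Multiset ℕ) (l : List ℕ) :
    proj K m (word K l) = if (l : Multiset ℕ) = m then word K l else 0 := by
  rw [proj, ← wordBasis_apply, Module.Basis.constr_basis, wordBasis_apply]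

theorem proj_mem (m : Multiset ℕ) (f : FreeAlgebra K ℕ) : proj K m f ∈ component K m := by
  refine map_mem_of_word (fun l => ?_) f
  rw [proj_word]
  split_ifs with h
  · exact h ▸ word_mem_component l
  · exact zero_mem _

theorem proj_eq_self {m : Multiset ℕ} {f : FreeAlgebra K ℕ} (hf : f ∈ component K m) :
    proj K m f = f := by
  have : component K m ≤ LinearMap.eqLocus (proj K m) LinearMap.id :=
    component_le fun l hl => by simp [proj_word, hl]
  exact this hf

/-- The right quotient by a word `w`: it sends `v ++ w` to `v`, and all other words to `0`. -/
noncomputable def rightQuot (K : Type*) [Field K] (w : List ℕ) :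
    FreeAlgebra K ℕ →ₗ[K] FreeAlgebra K ℕ :=
  (wordBasis K).constr K fun l => if w <:+ l then word K (l.take (l.length - w.length)) else 0

theorem rightQuot_word (w l : List ℕ) :
    rightQuot K w (word K l) = if w <:+ l then word K (l.take (l.length - w.length)) else 0 := by
  rw [rightQuot, ← wordBasis_apply, Module.Basis.constr_basis]

theorem rightQuot_mul_word_append (f : FreeAlgebra K ℕ) (u w : List ℕ) :
    rightQuot K w (f * word K (u ++ w)) = f * word K u := by
  have : rightQuot K w ∘ₗ LinearMap.mulRight K (word K (u ++ w)) =
      LinearMap.mulRight K (word K u) := by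
    refine linearMap_ext_word fun l => ?_
    have h : l ++ (u ++ w) = (l ++ u) ++ w := by simp
    rw [LinearMap.comp_apply, LinearMap.mulRight_apply, LinearMap.mulRight_apply, ← word_append,
      h, rightQuot_word, if_pos (List.suffix_append _ _), ← word_append]
    congr 1
    exact List.take_left' (by simp; omega)
  exact LinearMap.congr_fun this f

theorem rightQuot_mul_word_self (f : FreeAlgebra K ℕ) (w : List ℕ) :
    rightQuot K w (f * word K w) = f := by
  simpa using rightQuot_mul_word_append f [] w

/-- Of two suffixes of one word, the shorter is a suffix of the longer. -/
theorem rightQuot_mul_word_of_not_suffix (f : FreeAlgebra K ℕ) {w w' : List ℕ}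
    (hlen : w.length ≤ w'.length) (hw : ¬ w <:+ w') : rightQuot K w (f * word K w') = 0 := by
  have : rightQuot K w ∘ₗ LinearMap.mulRight K (word K w') = 0 := by
    refine linearMap_ext_word fun l => ?_
    rw [LinearMap.comp_apply, LinearMap.mulRight_apply, ← word_append, rightQuot_word, if_neg]
    · simp
    · intro h
      exact hw (List.suffix_of_suffix_length_le h (List.suffix_append _ _) hlen)
  exact LinearMap.congr_fun this f

/-- An element of `U * component K m` is the sum of its right quotients, multiplied by the words. -/
theorem sum_rightQuot_mul_word {U : Submodule K (FreeAlgebra K ℕ)} {m : Multiset ℕ}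
    {f : FreeAlgebra K ℕ} (hf : f ∈ U * component K m) :
    ∑ w ∈ (finite_words m).toFinset, rightQuot K w f * word K w = f := by
  have : U * component K m ≤ LinearMap.eqLocus
      (∑ w ∈ (finite_words m).toFinset, LinearMap.mulRight K (word K w) ∘ₗ rightQuot K w)
      LinearMap.id := by
    refine mul_component_le fun u _ l hl => ?_
    rw [LinearMap.mem_eqLocus, LinearMap.sum_apply, LinearMap.id_apply,
      Finset.sum_eq_single_of_mem l (by simpa using hl)]
    · simp [rightQuot_mul_word_self]
    · intro w hw hwl
      have hw' : (w : Multiset ℕ) = l := by rw [hl]; simpa using hw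
      have hlen : w.length = l.length := by simpa using congrArg Multiset.card hw'
      rw [LinearMap.comp_apply, rightQuot_mul_word_of_not_suffix u hlen.le fun h =>
        hwl (h.eq_of_length hlen), map_zero]
  simpa using this hf

theorem eq_zero_of_rightQuot_eq_zero {U : Submodule K (FreeAlgebra K ℕ)} {m : Multiset ℕ}
    {f : FreeAlgebra K ℕ} (hf : f ∈ U * component K m)
    (h : ∀ w : List ℕ, (w : Multiset ℕ) = m → rightQuot K w f = 0) : f = 0 := by
  rw [← sum_rightQuot_mul_word hf]
  refine Finset.sum_eq_zero fun w hw => ?_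
  rw [h w (by simpa using hw), zero_mul]

theorem linearIndependent_word (s : Set (List ℕ)) :
    LinearIndependent K fun l : s => word K l := by
  have := (wordBasis K).linearIndependent.comp ((↑) : s → List ℕ) Subtype.val_injective
  simpa [Function.comp_def] using this

/-- Words with the same letters have equal length, so none is a proper suffix of another; the right
quotient by one of them therefore isolates its coefficient in a sum of products. -/
theorem linearDisjoint_component (m : Multiset ℕ) :
    Submodule.LinearDisjoint (⊤ : Submodule K (FreeAlgebra K ℕ)) (component K m) := by
  let s : Set (List ℕ) := {l | (l : Multiset ℕ) = m}
  have hs : Set.range (fun l : s => word K l) = word K '' s := by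
    rw [Set.image_eq_range]
  let b : Module.Basis s K (component K m) :=
    (Module.Basis.span (linearIndependent_word s)).map (LinearEquiv.ofEq _ _ (by rw [hs]; rfl))
  have hb : ∀ l, (b l : FreeAlgebra K ℕ) = word K l := fun l => by
    simp [b, Module.Basis.span_apply]
  refine Submodule.LinearDisjoint.of_basis_right' _ _ b ?_
  rw [injective_iff_map_eq_zero]
  intro c hc
  ext w
  have h := congrArg (rightQuot K (w : List ℕ)) hc
  rw [Submodule.mulRightMap_apply, Finsupp.sum, map_sum, map_zero] at h
  rw [Finset.sum_eq_single w] at h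
  · simpa [hb, rightQuot_mul_word_self] using h
  · intro w' _ hne
    have hw : ((w : List ℕ) : Multiset ℕ) = (w' : List ℕ) := w.2.trans w'.2.symm
    have hlen : (w : List ℕ).length = (w' : List ℕ).length := by
      simpa using congrArg Multiset.card hw
    rw [hb, rightQuot_mul_word_of_not_suffix _ hlen.le fun h =>
      hne (Subtype.ext (h.eq_of_length hlen).symm)]
  · intro hw
    simp [Finsupp.notMem_support_iff.1 hw]

theorem finrank_mul {U V : Submodule K (FreeAlgebra K ℕ)} {m : Multiset ℕ}
    (hV : V ≤ component K m) :
    Module.finrank K (U * V : Submodule K (FreeAlgebra K ℕ)) =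
      Module.finrank K U * Module.finrank K V := by
  have h : U.LinearDisjoint V := (linearDisjoint_component m).of_le_of_flat_right le_top hV
  rw [← h.mulMap.finrank_eq, Module.finrank_tensorProduct]

end FreeAlgebra

/-! ### T-ideals and their multilinear components. -/

/-- A T-ideal: a two-sided ideal stable under all endomorphisms of the free algebra. -/
structure IsTIdeal {K : Type*} [Field K] (T : Submodule K (FreeAlgebra K ℕ)) : Prop where
  mul_mem_left : ∀ f {g}, g ∈ T → f * g ∈ T
  mul_mem_right : ∀ {f} g, f ∈ T → f * g ∈ T
  lift_mem : ∀ (s : ℕ → FreeAlgebra K ℕ) {f}, f ∈ T → FreeAlgebra.lift K s f ∈ T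

theorem isTIdeal_identitiesOf (K : Type*) [Field K] (R : Type*) [Ring R] [Algebra K R] :
    IsTIdeal (identitiesOf K R) where
  mul_mem_left f g hg r := by rw [map_mul, hg r, mul_zero]
  mul_mem_right g hf r := by rw [map_mul, hf r, zero_mul]
  lift_mem s f hf r := by
    have : (FreeAlgebra.lift K r).comp (FreeAlgebra.lift K s) =
        FreeAlgebra.lift K fun i => FreeAlgebra.lift K r (s i) := by
      ext i
      simp
    exact (DFunLike.congr_fun this f).trans (hf _)

namespace FreeAlgebra

variable {K : Type*} [Field K]

theorem lift_word {A : Type*} [Ring A] [Algebra K A] (s : ℕ → A) (l : List ℕ) :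
    lift K s (word K l) = (l.map s).prod := by
  rw [word, map_list_prod, List.map_map]
  congr 1
  refine List.map_congr_left fun i _ => ?_
  simp

theorem prod_map_X (l : List ℕ) :
    (l.map (MvPolynomial.X (R := K))).prod =
      MvPolynomial.monomial (Multiset.toFinsupp (l : Multiset ℕ)) 1 := by
  induction l with
  | nil => simp
  | cons i l ih =>
    rw [List.map_cons, List.prod_cons, ih, MvPolynomial.X, MvPolynomial.monomial_mul, one_mul,
      ← Multiset.cons_coe, ← Multiset.singleton_add, map_add, Multiset.toFinsupp_singleton]

theorem prod_map_smul_ι (c : ℕ → K) (l : List ℕ) :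
    (l.map fun i => c i • ι K i).prod = (l.map c).prod • word K l := by
  induction l with
  | nil => simp
  | cons i l ih =>
    rw [List.map_cons, List.prod_cons, ih, List.map_cons, List.prod_cons, word_cons,
      smul_mul_smul_comm]

end FreeAlgebra

section

open FreeAlgebra

variable {K : Type*} [Field K]

/-- T-ideals over an infinite field are multihomogeneous. -/
theorem IsTIdeal.proj_mem [Infinite K] {T : Submodule K (FreeAlgebra K ℕ)} (hT : IsTIdeal T)
    (m : Multiset ℕ) {f : FreeAlgebra K ℕ} (hf : f ∈ T) : proj K m f ∈ T := by
  by_contra hm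
  -- Separate the projection from `T` by a functional φ. Rescaling x_i to c_i x_i makes φ a
  -- polynomial in the c_i, namely `Φ f`, whose coefficient at `m` is φ of the projection. It
  -- vanishes at every c, so it is zero over an infinite field.
  obtain ⟨φ, hφ, hTφ⟩ := Submodule.exists_le_ker_of_notMem hm
  let Φ : FreeAlgebra K ℕ →ₗ[K] MvPolynomial ℕ K :=
    (wordBasis K).constr K fun l => φ (word K l) • (l.map MvPolynomial.X).prod
  have hΦ : ∀ l, Φ (word K l) = φ (word K l) • (l.map MvPolynomial.X).prod := fun l => by
    rw [← wordBasis_apply, Module.Basis.constr_basis, wordBasis_apply]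
  have heval : ∀ c : ℕ → K, (MvPolynomial.aeval c).toLinearMap ∘ₗ Φ =
      φ ∘ₗ (lift K fun i => c i • ι K i).toLinearMap := fun c => by
    refine linearMap_ext_word fun l => ?_
    simp only [LinearMap.comp_apply, AlgHom.toLinearMap_apply]
    rw [hΦ, lift_word, prod_map_smul_ι, map_smul, map_smul, map_list_prod, List.map_map]
    simp [Function.comp_def, mul_comm]
  have h0 : Φ f = 0 := by
    refine MvPolynomial.funext fun c => ?_
    have := LinearMap.congr_fun (heval c) f
    simp only [LinearMap.comp_apply, AlgHom.toLinearMap_apply] at this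
    rw [map_zero, ← MvPolynomial.coe_aeval_eq_eval]
    exact this.trans (hTφ (hT.lift_mem _ hf))
  have hcoeff : MvPolynomial.lcoeff K (Multiset.toFinsupp m) ∘ₗ Φ = φ ∘ₗ proj K m := by
    refine linearMap_ext_word fun l => ?_
    rw [LinearMap.comp_apply, LinearMap.comp_apply, hΦ, proj_word, prod_map_X,
      MvPolynomial.lcoeff_apply, MvPolynomial.coeff_smul, MvPolynomial.coeff_monomial]
    by_cases h : (l : Multiset ℕ) = m
    · simp [h]
    · rw [if_neg h, if_neg fun h' => h (Multiset.toFinsupp.injective h')]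
      simp
  apply hφ
  have := LinearMap.congr_fun hcoeff f
  rw [LinearMap.comp_apply, LinearMap.comp_apply, h0, map_zero] at this
  exact this.symm

/-- The dimension of a multilinear component of a T-ideal depends only on the number of variables. -/
theorem IsTIdeal.finrank_inf_component_le {T : Submodule K (FreeAlgebra K ℕ)} (hT : IsTIdeal T)
    {S S' : Finset ℕ} (h : S.card = S'.card) :
    Module.finrank K (T ⊓ component K S.val : Submodule K (FreeAlgebra K ℕ)) ≤
      Module.finrank K (T ⊓ component K S'.val : Submodule K (FreeAlgebra K ℕ)) := by
  let e := Finset.equivOfCardEq h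
  -- Relabel the letters along a bijection; the value 0 outside `S` is never used.
  let g : ℕ → ℕ := fun i => if hi : i ∈ S then e ⟨i, hi⟩ else 0
  let g' : ℕ → ℕ := fun i => if hi : i ∈ S' then e.symm ⟨i, hi⟩ else 0
  have hg : ∀ i ∈ S, g' (g i) = i := fun i hi => by simp [g, g', hi]
  have hgS : Multiset.map g S.val = S'.val := by
    have : S.image g = S' := by
      ext j
      rw [Finset.mem_image]
      constructor
      · rintro ⟨i, hi, rfl⟩
        simp [g, hi]
      · intro hj
        exact ⟨e.symm ⟨j, hj⟩, (e.symm ⟨j, hj⟩).2, by simp [g]⟩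
    rw [← this, Finset.image_val_of_injOn]
    intro i hi j hj hij
    rw [← hg i hi, ← hg j hj, hij]
  let ψ : FreeAlgebra K ℕ →ₐ[K] FreeAlgebra K ℕ := lift K fun i => ι K (g i)
  let ψ' : FreeAlgebra K ℕ →ₐ[K] FreeAlgebra K ℕ := lift K fun i => ι K (g' i)
  have hψ : ∀ l, ψ (word K l) = word K (l.map g) := fun l => by
    rw [lift_word, word, List.map_map]; rfl
  have hψ' : ∀ l, ψ' (word K l) = word K (l.map g') := fun l => by
    rw [lift_word, word, List.map_map]; rfl
  have hleft : ∀ f ∈ component K S.val, ψ' (ψ f) = f := by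
    intro f hf
    have : component K S.val ≤ LinearMap.eqLocus (ψ'.toLinearMap ∘ₗ ψ.toLinearMap)
        LinearMap.id := by
      refine component_le fun l hl => ?_
      simp only [LinearMap.mem_eqLocus, LinearMap.comp_apply, AlgHom.toLinearMap_apply,
        LinearMap.id_apply]
      rw [hψ, hψ', List.map_map]
      congr 1
      conv_rhs => rw [← List.map_id l]
      refine List.map_congr_left fun i hi => hg i ?_
      rw [← Finset.mem_val, ← hl]
      exact hi
    exact this hf
  have hmaps : ∀ f ∈ T ⊓ component K S.val, ψ.toLinearMap f ∈ T ⊓ component K S'.val := by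
    rintro f ⟨hfT, hf⟩
    refine ⟨hT.lift_mem _ hfT, ?_⟩
    have : component K S.val ≤ (component K S'.val).comap ψ.toLinearMap := by
      refine component_le fun l hl => ?_
      rw [Submodule.mem_comap, AlgHom.toLinearMap_apply, hψ, ← hgS, ← hl, Multiset.map_coe]
      exact word_mem_component _
    exact this hf
  refine LinearMap.finrank_le_finrank_of_injective (f := ψ.toLinearMap.restrict hmaps) ?_
  rintro ⟨f, hf⟩ ⟨f', hf'⟩ hff
  have h1 : ψ f = ψ f' := congrArg Subtype.val hff
  rw [Subtype.mk.injEq, ← hleft f hf.2, ← hleft f' hf'.2, h1]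

theorem IsTIdeal.finrank_inf_component_eq {T : Submodule K (FreeAlgebra K ℕ)} (hT : IsTIdeal T)
    (S : Finset ℕ) :
    Module.finrank K (T ⊓ component K S.val : Submodule K (FreeAlgebra K ℕ)) =
      Module.finrank K
        (T ⊓ component K (Finset.range S.card).val : Submodule K (FreeAlgebra K ℕ)) :=
  le_antisymm (hT.finrank_inf_component_le (by simp)) (hT.finrank_inf_component_le (by simp))

/-- The dimension of a finite sum of subspaces that is direct with respect to a ranking. -/
theorem Submodule.finrank_finset_sup_of_disjoint {K V ι : Type*} [Field K] [AddCommGroup V]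
    [Module K V] [DecidableEq ι] (A : ι → Submodule K V) [∀ i, FiniteDimensional K (A i)]
    (rank : ι → ℕ) (s : Finset ι)
    (h : ∀ i ∈ s, ∀ t ⊆ s, (∀ j ∈ t, j ≠ i ∧ rank j ≤ rank i) → Disjoint (A i) (t.sup A)) :
    Module.finrank K (s.sup A : Submodule K V) = ∑ i ∈ s, Module.finrank K (A i) := by
  induction s using Finset.induction_on_max_value rank with
  | empty => simp
  | insert a s ha hmax ih =>
    rw [Finset.sup_insert, Finset.sum_insert ha, ← ih fun i hi t ht hj =>
      h i (Finset.mem_insert_of_mem hi) t (ht.trans (Finset.subset_insert _ _)) hj]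
    have hd := h a (Finset.mem_insert_self _ _) s (Finset.subset_insert _ _)
      fun j hj => ⟨fun hja => ha (hja ▸ hj), hmax j hj⟩
    have := Submodule.finrank_sup_add_finrank_inf_eq (A a) (s.sup A)
    rwa [hd.eq_bot, finrank_bot, add_zero] at this

theorem Submodule.finset_sup_mul_le {K A ι : Type*} [CommSemiring K] [Semiring A] [Algebra K A]
    {s : Finset ι} {B : ι → Submodule K A} {V Y : Submodule K A} (h : ∀ i ∈ s, B i * V ≤ Y) :
    s.sup B * V ≤ Y := by
  refine Submodule.mul_le.2 fun u hu v hv => ?_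
  have : s.sup B ≤ Y.comap (LinearMap.mulRight K v) :=
    Finset.sup_le fun i hi b hb => h i hi (Submodule.mul_mem_mul hb hv)
  exact this hu

/-! ### Multilinear polynomials and codimensions. -/

theorem isTIdeal_top : IsTIdeal (⊤ : Submodule K (FreeAlgebra K ℕ)) :=
  ⟨fun _ _ _ => trivial, fun _ _ => trivial, fun _ _ _ => trivial⟩

theorem multilinearPolys_eq_span (n : ℕ) : multilinearPolys K n =
    Submodule.span K (Set.range fun σ : Equiv.Perm (Fin n) =>
      word K (List.ofFn fun i : Fin n => ((σ i : Fin n) : ℕ))) := by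
  rw [multilinearPolys]
  congr 3
  ext σ
  rw [word, List.map_ofFn]
  rfl

theorem ofFn_perm_injective (n : ℕ) : Function.Injective fun σ : Equiv.Perm (Fin n) =>
    List.ofFn fun i : Fin n => ((σ i : Fin n) : ℕ) := by
  intro σ τ h
  ext i
  exact congrFun (List.ofFn_injective h) i

theorem exists_perm_of_coe_eq_range {n : ℕ} {l : List ℕ}
    (hl : (l : Multiset ℕ) = (Finset.range n).val) :
    ∃ σ : Equiv.Perm (Fin n), (List.ofFn fun i : Fin n => ((σ i : Fin n) : ℕ)) = l := by
  have hlen : l.length = n := by simpa using congrArg Multiset.card hl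
  subst hlen
  have hnd : l.Nodup := by
    rw [← Multiset.coe_nodup, hl]
    exact (Finset.range _).nodup
  have hlt : ∀ i : Fin l.length, l.get i < l.length := fun i => by
    have : l.get i ∈ (l : Multiset ℕ) := List.get_mem l i
    rw [hl] at this
    simpa using this
  let σ : Fin l.length → Fin l.length := fun i => ⟨l.get i, hlt i⟩
  have hσ : Function.Injective σ := fun i j hij =>
    List.nodup_iff_injective_get.1 hnd (congrArg Fin.val hij)
  refine ⟨Equiv.ofBijective σ (Finite.injective_iff_bijective.1 hσ), ?_⟩
  exact List.ofFn_get l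

theorem coe_ofFn_perm {n : ℕ} (σ : Equiv.Perm (Fin n)) :
    ((List.ofFn fun i : Fin n => ((σ i : Fin n) : ℕ) : List ℕ) : Multiset ℕ) =
      (Finset.range n).val := by
  refine (Multiset.Nodup.ext ?_ (Finset.range n).nodup).2 fun a => ?_
  · rw [Multiset.coe_nodup, List.nodup_ofFn]
    exact Fin.val_injective.comp σ.injective
  · rw [Multiset.mem_coe, List.mem_ofFn]
    constructor
    · rintro ⟨i, rfl⟩
      simp
    · intro ha
      have ha' : a < n := by simpa using ha
      exact ⟨σ.symm ⟨a, ha'⟩, by simp⟩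

theorem multilinearPolys_eq_component (n : ℕ) :
    multilinearPolys K n = component K (Finset.range n).val := by
  rw [multilinearPolys_eq_span]
  refine le_antisymm (Submodule.span_le.2 ?_) (component_le fun l hl => ?_)
  · rintro _ ⟨σ, rfl⟩
    exact coe_ofFn_perm σ ▸ word_mem_component _
  · obtain ⟨σ, rfl⟩ := exists_perm_of_coe_eq_range hl
    exact Submodule.subset_span ⟨σ, rfl⟩

theorem finrank_multilinearPolys (n : ℕ) :
    Module.finrank K (multilinearPolys K n) = n.factorial := by
  have h : LinearIndependent K fun σ : Equiv.Perm (Fin n) =>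
      word K (List.ofFn fun i : Fin n => ((σ i : Fin n) : ℕ)) := by
    have := (wordBasis K).linearIndependent.comp _ (ofFn_perm_injective n)
    simpa [Function.comp_def] using this
  rw [multilinearPolys_eq_span, finrank_span_eq_card h, Fintype.card_perm, Fintype.card_fin]

theorem finrank_component (S : Finset ℕ) :
    Module.finrank K (component K S.val) = S.card.factorial := by
  have := (isTIdeal_top (K := K)).finrank_inf_component_eq S
  rwa [top_inf_eq, top_inf_eq, ← multilinearPolys_eq_component, finrank_multilinearPolys] at this

/-- The dimension of the space of multilinear elements of degree `n` of a subspace. -/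
noncomputable def multilinearDim (T : Submodule K (FreeAlgebra K ℕ)) (n : ℕ) : ℕ :=
  Module.finrank K (T ⊓ component K (Finset.range n).val : Submodule K (FreeAlgebra K ℕ))

theorem codimension_add_multilinearDim (R : Type*) [Ring R] [Algebra K R] (n : ℕ) :
    codimension K R n + multilinearDim (identitiesOf K R) n = n.factorial := by
  have : FiniteDimensional K (multilinearPolys K n) := by
    rw [multilinearPolys_eq_component]; infer_instance
  have h := Submodule.finrank_quotient_add_finrank
    ((identitiesOf K R).submoduleOf (multilinearPolys K n))
  rw [finrank_multilinearPolys] at h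
  rw [codimension, ← h, multilinearDim, ← multilinearPolys_eq_component, inf_comm,
    ← Submodule.map_comap_subtype, Submodule.finrank_map_subtype_eq]
  rfl

namespace FreeAlgebra

/-- As `M` has no repeated letters, a factorization of a multilinear word splits `M` into a subset
and its complement. -/
theorem proj_mul (M : Finset ℕ) (f g : FreeAlgebra K ℕ) :
    proj K M.val (f * g) = ∑ S ∈ M.powerset, proj K S.val f * proj K (M \ S).val g := by
  have hw : ∀ l l', proj K M.val (word K l * word K l') =
      ∑ S ∈ M.powerset, proj K S.val (word K l) * proj K (M \ S).val (word K l') := by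
    intro l l'
    rw [← word_append, proj_word]
    split_ifs with h
    · rw [← Multiset.coe_add] at h
      have hnd : (l : Multiset ℕ).Nodup :=
        Multiset.nodup_of_le (Multiset.le_add_right _ _) (h ▸ M.nodup)
      let S : Finset ℕ := ⟨l, hnd⟩
      have hSM : S ⊆ M := Finset.val_le_iff.1 (h ▸ Multiset.le_add_right _ _)
      have hl' : (l' : Multiset ℕ) = (M \ S).val := by
        rw [Finset.sdiff_val, ← h]
        exact (add_tsub_cancel_left _ _).symm
      rw [Finset.sum_eq_single_of_mem S (Finset.mem_powerset.2 hSM)]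
      · rw [proj_word, proj_word, if_pos rfl, if_pos hl', word_append]
      · intro S' _ hS'
        rw [proj_word, if_neg, zero_mul]
        intro h'
        exact hS' (Finset.val_injective h'.symm)
    · refine (Finset.sum_eq_zero fun S hS => ?_).symm
      rw [proj_word, proj_word]
      split_ifs with h1 h2
      · refine absurd ?_ h
        rw [← Multiset.coe_add, h1, h2, Finset.sdiff_val]
        exact add_tsub_cancel_of_le (Finset.val_le_iff.2 (Finset.mem_powerset.1 hS))
      · simp
      · simp
      · simp
  have hw' : ∀ l g, proj K M.val (word K l * g) =
      ∑ S ∈ M.powerset, proj K S.val (word K l) * proj K (M \ S).val g := by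
    intro l g
    have : proj K M.val ∘ₗ LinearMap.mulLeft K (word K l) =
        ∑ S ∈ M.powerset, LinearMap.mulLeft K (proj K S.val (word K l)) ∘ₗ proj K (M \ S).val :=
      linearMap_ext_word fun l' => by simpa using hw l l'
    simpa using LinearMap.congr_fun this g
  have : proj K M.val ∘ₗ LinearMap.mulRight K g =
      ∑ S ∈ M.powerset, LinearMap.mulRight K (proj K (M \ S).val g) ∘ₗ proj K S.val :=
    linearMap_ext_word fun l' => by simpa using hw' l' g
  simpa using LinearMap.congr_fun this f

end FreeAlgebra

/-! ### Decomposable elements and their complements. -/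

/-- The multilinear elements of a right ideal in the letters `S` that come from lower degree. -/
noncomputable def decomposables (T : Submodule K (FreeAlgebra K ℕ)) (S : Finset ℕ) :
    Submodule K (FreeAlgebra K ℕ) :=
  S.sup fun i => (T ⊓ component K (S.erase i).val) * component K {i}

theorem mul_word_mem_component {S S' : Finset ℕ} {u : FreeAlgebra K ℕ} {l : List ℕ}
    (hu : u ∈ component K S.val) (h : S.val + l = S'.val) : u * word K l ∈ component K S'.val :=
  h ▸ component_mul_component_le _ _ (Submodule.mul_mem_mul hu (word_mem_component l))

instance finiteDimensional_inf_component (T : Submodule K (FreeAlgebra K ℕ)) (m : Multiset ℕ) :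
    FiniteDimensional K (T ⊓ component K m : Submodule K (FreeAlgebra K ℕ)) :=
  Submodule.finiteDimensional_of_le inf_le_right

theorem eq_singleton_of_coe_eq_singleton {l : List ℕ} {i : ℕ} (h : (l : Multiset ℕ) = {i}) :
    l = [i] := by
  rw [← Multiset.coe_singleton, Multiset.coe_eq_coe] at h
  exact List.perm_singleton.1 h

theorem IsTIdeal.decomposables_le {T : Submodule K (FreeAlgebra K ℕ)} (hT : IsTIdeal T)
    (S : Finset ℕ) : decomposables T S ≤ T ⊓ component K S.val := by
  refine Finset.sup_le fun i hi => mul_component_le fun u hu l hl => ?_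
  refine ⟨hT.mul_mem_right _ hu.1, mul_word_mem_component hu.2 ?_⟩
  rw [hl, add_comm, Multiset.singleton_add, Finset.erase_val, Multiset.cons_erase hi]

/-- The sum is direct because summands for different i consist of combinations of words with
different last letters. -/
theorem finrank_decomposables (T : Submodule K (FreeAlgebra K ℕ)) (S : Finset ℕ) :
    Module.finrank K (decomposables T S) = ∑ i ∈ S,
      Module.finrank K (T ⊓ component K (S.erase i).val : Submodule K (FreeAlgebra K ℕ)) := by
  have hfin : ∀ i, FiniteDimensional K
      ((T ⊓ component K (S.erase i).val) * component K {i} : Submodule K (FreeAlgebra K ℕ)) :=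
    fun i => Submodule.finiteDimensional_of_le ((mul_le_mul' inf_le_right le_rfl).trans
      (component_mul_component_le _ _))
  rw [decomposables, Submodule.finrank_finset_sup_of_disjoint _ (fun _ => 0)]
  · refine Finset.sum_congr rfl fun i _ => ?_
    have h1 : Module.finrank K (component K ({i} : Multiset ℕ)) = 1 := by
      simpa using finrank_component (K := K) {i}
    rw [finrank_mul le_rfl, h1, mul_one]
  · intro i _ t _ hj
    rw [Submodule.disjoint_def]
    intro f hf hft
    refine eq_zero_of_rightQuot_eq_zero hf fun w hw => ?_
    rw [eq_singleton_of_coe_eq_singleton hw]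
    have : (t.sup fun i => (T ⊓ component K (S.erase i).val) * component K {i}) ≤
        LinearMap.ker (rightQuot K [i]) := by
      refine Finset.sup_le fun j hjt => mul_component_le fun u _ l hl => ?_
      rw [eq_singleton_of_coe_eq_singleton hl, LinearMap.mem_ker]
      refine rightQuot_mul_word_of_not_suffix _ le_rfl fun h => (hj j hjt).1 ?_
      simpa using (h.eq_of_length rfl).symm
    exact this hft

/-- The complement `U` plays the role of the free generators of `T`, as a right ideal, in the
letters `S`. -/
theorem IsTIdeal.exists_compl_decomposables {T : Submodule K (FreeAlgebra K ℕ)} (hT : IsTIdeal T)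
    (S : Finset ℕ) : ∃ U : Submodule K (FreeAlgebra K ℕ),
      Disjoint U (decomposables T S) ∧ U ⊔ decomposables T S = T ⊓ component K S.val := by
  obtain ⟨C, hC⟩ := Submodule.exists_isCompl (decomposables T S)
  refine ⟨C ⊓ (T ⊓ component K S.val), hC.disjoint.symm.mono_left inf_le_left, ?_⟩
  rw [sup_comm, ← sup_inf_assoc_of_le _ (hT.decomposables_le S), hC.sup_eq_top, top_inf_eq]

/-! ### The multilinear part of a product of T-ideals. -/

section Product

variable {T₁ T₂ : Submodule K (FreeAlgebra K ℕ)} {U : Finset ℕ → Submodule K (FreeAlgebra K ℕ)}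

theorem mul_inf_component_le [Infinite K] (h₁ : IsTIdeal T₁) (h₂ : IsTIdeal T₂) (M : Finset ℕ) :
    T₁ * T₂ ⊓ component K M.val ≤ M.powerset.sup fun S =>
      (T₁ ⊓ component K S.val) * (T₂ ⊓ component K (M \ S).val) := by
  rintro f ⟨hf, hfM⟩
  rw [← proj_eq_self hfM]
  have : T₁ * T₂ ≤ (M.powerset.sup fun S => (T₁ ⊓ component K S.val) *
      (T₂ ⊓ component K (M \ S).val)).comap (proj K M.val) := by
    refine Submodule.mul_le.2 fun u hu v hv => ?_
    rw [Submodule.mem_comap, proj_mul]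
    refine Submodule.sum_mem _ fun S hS => ?_
    exact Finset.le_sup (f := fun S => (T₁ ⊓ component K S.val) *
      (T₂ ⊓ component K (M \ S).val)) hS (Submodule.mul_mem_mul
        ⟨h₁.proj_mem _ hu, proj_mem _ _⟩ ⟨h₂.proj_mem _ hv, proj_mem _ _⟩)
  exact this hf

/-- A decomposable left factor can hand its last letter to the right factor, which stays in `T₂`
because `T₂` is a left ideal; this shrinks `S`. -/
theorem inf_component_mul_le (h₂ : IsTIdeal T₂)
    (hU : ∀ S, U S ⊔ decomposables T₁ S = T₁ ⊓ component K S.val) (M : Finset ℕ) :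
    ∀ S ⊆ M, (T₁ ⊓ component K S.val) * (T₂ ⊓ component K (M \ S).val) ≤
      M.powerset.sup fun S => U S * (T₂ ⊓ component K (M \ S).val) := by
  intro S
  induction S using Finset.strongInduction with
  | H S ih =>
  intro hS
  rw [← hU S, Submodule.sup_mul]
  refine sup_le (Finset.le_sup (f := fun S => U S * (T₂ ⊓ component K (M \ S).val))
    (Finset.mem_powerset.2 hS)) (Submodule.finset_sup_mul_le fun i hi => ?_)
  rw [mul_assoc]
  refine le_trans (mul_le_mul' le_rfl ?_)
    (ih (S.erase i) (Finset.erase_ssubset hi) ((Finset.erase_subset _ _).trans hS))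
  refine Submodule.mul_le.2 fun x hx v hv => ⟨h₂.mul_mem_left _ hv.1, ?_⟩
  have h := component_mul_component_le _ _ (Submodule.mul_mem_mul hx hv.2)
  rwa [Multiset.singleton_add, ← Finset.insert_val_of_notMem (by simp [hi]),
    ← Finset.sdiff_erase (hS hi)] at h

theorem mul_inf_component_eq [Infinite K] (h₁ : IsTIdeal T₁) (h₂ : IsTIdeal T₂)
    (hU : ∀ S, U S ⊔ decomposables T₁ S = T₁ ⊓ component K S.val) (M : Finset ℕ) :
    T₁ * T₂ ⊓ component K M.val =
      M.powerset.sup fun S => U S * (T₂ ⊓ component K (M \ S).val) := by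
  refine le_antisymm ((mul_inf_component_le h₁ h₂ M).trans (Finset.sup_le fun S hS =>
    inf_component_mul_le h₂ hU M S (Finset.mem_powerset.1 hS))) (Finset.sup_le fun S hS => ?_)
  have hUS : U S ≤ T₁ ⊓ component K S.val := le_sup_left.trans_eq (hU S)
  refine le_inf (mul_le_mul' (hUS.trans inf_le_left) inf_le_left) ?_
  refine (mul_le_mul' (hUS.trans inf_le_right) inf_le_right).trans
    ((component_mul_component_le _ _).trans_eq ?_)
  rw [Finset.sdiff_val, add_tsub_cancel_of_le (Finset.val_le_iff.2 (Finset.mem_powerset.1 hS))]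

/-- If l = v w, the quotient is u v. Here v is nonempty because S ≠ S₀, so u v ends in a letter and
its remaining left factor lies in `T₁`. -/
theorem rightQuot_mem_decomposables (h₁ : IsTIdeal T₁) {M S₀ S : Finset ℕ} (hS₀ : S₀ ⊆ M)
    (hS : S ⊆ M) (hne : S ≠ S₀) (hcard : S.card ≤ S₀.card) {w l : List ℕ}
    (hw : (w : Multiset ℕ) = (M \ S₀).val) (hl : (l : Multiset ℕ) = (M \ S).val)
    {u : FreeAlgebra K ℕ} (hu : u ∈ T₁ ⊓ component K S.val) :
    rightQuot K w (u * word K l) ∈ decomposables T₁ S₀ := by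
  have hlen : w.length ≤ l.length := by
    have h1 := congrArg Multiset.card hw
    have h2 := congrArg Multiset.card hl
    simp only [Multiset.coe_card, Finset.card_val] at h1 h2
    rw [h1, h2, Finset.card_sdiff_of_subset hS₀, Finset.card_sdiff_of_subset hS]
    omega
  by_cases hsuf : w <:+ l
  swap
  · rw [rightQuot_mul_word_of_not_suffix _ hlen hsuf]
    exact zero_mem _
  obtain ⟨v, rfl⟩ := hsuf
  rw [rightQuot_mul_word_append]
  have hval : S.val + v = S₀.val := by
    have h1 : S.val + (M \ S).val = S₀.val + (M \ S₀).val := by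
      rw [Finset.sdiff_val, Finset.sdiff_val, add_tsub_cancel_of_le (Finset.val_le_iff.2 hS),
        add_tsub_cancel_of_le (Finset.val_le_iff.2 hS₀)]
    rw [← hl, ← Multiset.coe_add, hw, ← add_assoc] at h1
    exact add_right_cancel h1
  rcases List.eq_nil_or_concat v with rfl | ⟨v', i, rfl⟩
  · exact absurd (Finset.val_injective (by simpa using hval)) hne
  · rw [List.concat_eq_append] at hval ⊢
    have hi : i ∈ S₀ := by
      rw [← Finset.mem_val, ← hval]
      simp
    have hval' : S.val + v' = (S₀.erase i).val := by
      rw [Finset.erase_val, ← hval, ← Multiset.coe_add, ← add_assoc,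
        Multiset.coe_singleton, add_comm _ ({i} : Multiset ℕ), Multiset.singleton_add, Multiset.erase_cons_head]
    rw [word_append, ← mul_assoc]
    refine Finset.le_sup (f := fun i => (T₁ ⊓ component K (S₀.erase i).val) * component K {i}) hi
      (Submodule.mul_mem_mul ⟨h₁.mul_mem_right _ hu.1, mul_word_mem_component hu.2 hval'⟩ ?_)
    exact word_mem_component [i]

theorem finrank_mul_inf_component [Infinite K] (h₁ : IsTIdeal T₁) (h₂ : IsTIdeal T₂)
    (hU : ∀ S, U S ⊔ decomposables T₁ S = T₁ ⊓ component K S.val)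
    (hd : ∀ S, Disjoint (U S) (decomposables T₁ S)) (M : Finset ℕ) :
    Module.finrank K (T₁ * T₂ ⊓ component K M.val : Submodule K (FreeAlgebra K ℕ)) =
      ∑ S ∈ M.powerset, Module.finrank K (U S) *
        Module.finrank K (T₂ ⊓ component K (M \ S).val : Submodule K (FreeAlgebra K ℕ)) := by
  have hUS : ∀ S, U S ≤ T₁ ⊓ component K S.val := fun S => le_sup_left.trans_eq (hU S)
  have hfin : ∀ S, FiniteDimensional K
      (U S * (T₂ ⊓ component K (M \ S).val) : Submodule K (FreeAlgebra K ℕ)) :=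
    fun S => Submodule.finiteDimensional_of_le
      ((mul_le_mul' ((hUS S).trans inf_le_right) inf_le_right).trans
        (component_mul_component_le _ _))
  -- Ranking by cardinality: a right quotient by a word in M \ S₀ sends the S₀-term into U_{S₀} and
  -- the terms with |S| ≤ |S₀| into the decomposables, which meet U_{S₀} only in 0.
  rw [mul_inf_component_eq h₁ h₂ hU, Submodule.finrank_finset_sup_of_disjoint _ Finset.card]
  · exact Finset.sum_congr rfl fun S _ => finrank_mul inf_le_right
  · intro S₀ hS₀ t ht hj
    rw [Finset.mem_powerset] at hS₀
    rw [Submodule.disjoint_def]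
    intro f hf hft
    have hf' : f ∈ U S₀ * component K (M \ S₀).val :=
      (mul_le_mul' le_rfl inf_le_right :
        U S₀ * (T₂ ⊓ component K (M \ S₀).val) ≤ U S₀ * component K (M \ S₀).val) hf
    refine eq_zero_of_rightQuot_eq_zero hf' fun w hw =>
      Submodule.disjoint_def.1 (hd S₀) _ ?_ ?_
    · have : U S₀ * component K (M \ S₀).val ≤ (U S₀).comap (rightQuot K w) := by
        refine mul_component_le fun u hu l hl => ?_
        have hwl : (w : Multiset ℕ) = l := hw.trans hl.symm
        have hlen : w.length = l.length := by simpa using congrArg Multiset.card hwl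
        rw [Submodule.mem_comap]
        by_cases h : w = l
        · rw [h, rightQuot_mul_word_self]
          exact hu
        · rw [rightQuot_mul_word_of_not_suffix _ hlen.le fun h' => h (h'.eq_of_length hlen)]
          exact zero_mem _
      exact this hf'
    · have : (t.sup fun S => U S * (T₂ ⊓ component K (M \ S).val)) ≤
          (decomposables T₁ S₀).comap (rightQuot K w) := by
        refine Finset.sup_le fun S hS => (mul_le_mul' le_rfl inf_le_right).trans
          (mul_component_le fun u hu l hl => ?_)
        exact rightQuot_mem_decomposables h₁ hS₀ (Finset.mem_powerset.1 (ht hS)) (hj S hS).1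
          (hj S hS).2 hw hl (hUS S hu)
      exact this hft

/-- The multilinear dimensions of a product of two T-ideals. -/
theorem exists_multilinearDim_mul [Infinite K] (h₁ : IsTIdeal T₁) (h₂ : IsTIdeal T₂) :
    ∃ u : ℕ → ℕ, (∀ n, u n + n * multilinearDim T₁ (n - 1) = multilinearDim T₁ n) ∧
      ∀ n, multilinearDim (T₁ * T₂) n =
        ∑ k ∈ Finset.range (n + 1), n.choose k * (u k * multilinearDim T₂ (n - k)) := by
  choose U hd hU using h₁.exists_compl_decomposables
  have hu : ∀ S : Finset ℕ, Module.finrank K (U S) +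
      S.card * multilinearDim T₁ (S.card - 1) = multilinearDim T₁ S.card := by
    intro S
    have hUS : U S ≤ T₁ ⊓ component K S.val := le_sup_left.trans_eq (hU S)
    have : FiniteDimensional K (U S) := Submodule.finiteDimensional_of_le hUS
    have : FiniteDimensional K (decomposables T₁ S) :=
      Submodule.finiteDimensional_of_le (h₁.decomposables_le S)
    have h := Submodule.finrank_sup_add_finrank_inf_eq (U S) (decomposables T₁ S)
    rw [(hd S).eq_bot, finrank_bot, add_zero, hU S, h₁.finrank_inf_component_eq,
      finrank_decomposables] at h
    have hsum : ∀ i ∈ S, Module.finrank K (T₁ ⊓ component K (S.erase i).val :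
        Submodule K (FreeAlgebra K ℕ)) = multilinearDim T₁ (S.card - 1) := fun i hi => by
      rw [h₁.finrank_inf_component_eq, Finset.card_erase_of_mem hi, multilinearDim]
    rw [Finset.sum_congr rfl hsum, Finset.sum_const, smul_eq_mul] at h
    exact h.symm
  -- By `hu` the subtraction is never truncated; for n = 0 the index n - 1 is harmless, being
  -- multiplied by 0.
  refine ⟨fun n => multilinearDim T₁ n - n * multilinearDim T₁ (n - 1), fun n => ?_, fun n => ?_⟩
  · have := hu (Finset.range n)
    rw [Finset.card_range] at this
    simp only []
    omega
  · rw [multilinearDim, finrank_mul_inf_component h₁ h₂ hU hd]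
    have : ∀ S ∈ (Finset.range n).powerset, Module.finrank K (U S) * Module.finrank K
        (T₂ ⊓ component K (Finset.range n \ S).val : Submodule K (FreeAlgebra K ℕ)) =
        (fun k => (multilinearDim T₁ k - k * multilinearDim T₁ (k - 1)) *
          multilinearDim T₂ (n - k)) S.card := by
      intro S hS
      rw [h₂.finrank_inf_component_eq, Finset.card_sdiff_of_subset (Finset.mem_powerset.1 hS),
        Finset.card_range]
      simp only []
      rw [← hu S, Nat.add_sub_cancel, multilinearDim]
    rw [Finset.sum_congr rfl this, Finset.sum_powerset_apply_card (fun k =>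
      (multilinearDim T₁ k - k * multilinearDim T₁ (k - 1)) * multilinearDim T₂ (n - k)),
      Finset.card_range]
    simp

end Product

/-! ### Generating functions and the codimension series of a product. -/

open PowerSeries in
theorem PowerSeries.coeff_borel_mul_borel (a b : ℕ → ℂ) (n : ℕ) :
    coeff n (borel (mk a) * borel (mk b)) =
      (n.factorial : ℂ)⁻¹ * ∑ k ∈ Finset.range (n + 1), (n.choose k : ℂ) * (a k * b (n - k)) := by
  rw [coeff_mul, Finset.Nat.sum_antidiagonal_eq_sum_range_succ_mk, Finset.mul_sum]
  refine Finset.sum_congr rfl fun k hk => ?_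
  have hkn : k ≤ n := by simpa [Nat.lt_succ_iff] using hk
  rw [coeff_borel, coeff_borel, coeff_mk, coeff_mk, Nat.cast_choose ℂ hkn]
  have h1 : (n.factorial : ℂ) ≠ 0 := by exact_mod_cast n.factorial_ne_zero
  have h2 : (k.factorial : ℂ) ≠ 0 := by exact_mod_cast k.factorial_ne_zero
  have h3 : ((n - k).factorial : ℂ) ≠ 0 := by exact_mod_cast (n - k).factorial_ne_zero
  field_simp

/-- The generating function of the dimensions of the multilinear components. -/
noncomputable def multilinearSeries (T : Submodule K (FreeAlgebra K ℕ)) : PowerSeries ℂ :=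
  PowerSeries.mk fun n => (multilinearDim T n : ℂ)

open PowerSeries

theorem borel_multilinearSeries_mul [Infinite K] {T₁ T₂ : Submodule K (FreeAlgebra K ℕ)}
    (h₁ : IsTIdeal T₁) (h₂ : IsTIdeal T₂) : borel (multilinearSeries (T₁ * T₂)) =
      (1 - X) * borel (multilinearSeries T₁) * borel (multilinearSeries T₂) := by
  obtain ⟨u, hu, hmul⟩ := exists_multilinearDim_mul h₁ h₂
  -- Passing from d_n to n d_{n-1} is multiplication by X on exponential generating functions.
  have h1 : borel (mk fun n => (u n : ℂ)) = (1 - X) * borel (multilinearSeries T₁) := by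
    ext n
    rw [sub_mul, one_mul, map_sub, coeff_borel, coeff_borel, multilinearSeries, coeff_mk,
      coeff_mk, ← hu n]
    cases n with
    | zero => simp
    | succ n =>
      rw [coeff_succ_X_mul, coeff_borel, coeff_mk, Nat.factorial_succ, Nat.add_sub_cancel]
      have h2 : (n.factorial : ℂ) ≠ 0 := by exact_mod_cast n.factorial_ne_zero
      have h3 : (n : ℂ) + 1 ≠ 0 := by exact_mod_cast n.succ_ne_zero
      push_cast
      field_simp
      ring
  rw [← h1]
  ext n
  rw [multilinearSeries, multilinearSeries, coeff_borel_mul_borel, coeff_borel, coeff_mk, hmul]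
  push_cast
  rfl

theorem borel_codimensionSeries (R : Type*) [Ring R] [Algebra K R] :
    borel (codimensionSeries K R) = mk 1 - borel (multilinearSeries (identitiesOf K R)) := by
  ext n
  have h : (codimension K R n : ℂ) + multilinearDim (identitiesOf K R) n = n.factorial := by
    exact_mod_cast codimension_add_multilinearDim R n
  have h2 : (n.factorial : ℂ) ≠ 0 := by exact_mod_cast n.factorial_ne_zero
  rw [map_sub, coeff_borel, coeff_borel, codimensionSeries, multilinearSeries, coeff_mk, coeff_mk,
    coeff_mk, Pi.one_apply, eq_sub_iff_add_eq, ← mul_add, h, inv_mul_cancel₀ h2]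

theorem codimensionSeries_eq [Infinite K] {R₁ R₂ R : Type*} [Ring R₁] [Algebra K R₁] [Ring R₂]
    [Algebra K R₂] [Ring R] [Algebra K R]
    (hT : identitiesOf K R = identitiesOf K R₁ * identitiesOf K R₂) :
    codimensionSeries K R = codimensionSeries K R₁ + codimensionSeries K R₂ -
      laplace (borel (codimensionSeries K R₁) * borel (codimensionSeries K R₂)) +
      X * derivative ℂ
        (X * laplace (borel (codimensionSeries K R₁) * borel (codimensionSeries K R₂))) := by
  rw [← laplace_X_mul]
  -- It suffices to compare Borel transforms, where the claim is E = E₁ + E₂ - (1 - X) E₁ E₂ with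
  -- E_i = 1/(1 - X) - D_i.
  apply Function.LeftInverse.injective laplace_borel
  simp only [map_add, map_sub, borel_laplace]
  have h := borel_multilinearSeries_mul (isTIdeal_identitiesOf K R₁) (isTIdeal_identitiesOf K R₂)
  rw [← hT] at h
  have h0 := mk_one_mul_one_sub_eq_one ℂ
  rw [borel_codimensionSeries, borel_codimensionSeries, borel_codimensionSeries, h]
  linear_combination (mk 1 - borel (multilinearSeries (identitiesOf K R₁)) -
    borel (multilinearSeries (identitiesOf K R₂))) * h0

theorem IsConvolutionClosed.codimensionSeries_mem [Infinite K]
    {B : Subalgebra (Polynomial ℂ) (PowerSeries ℂ)} (hB : IsConvolutionClosed B)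
    {R₁ R₂ R : Type*} [Ring R₁] [Algebra K R₁] [Ring R₂] [Algebra K R₂] [Ring R] [Algebra K R]
    (hT : identitiesOf K R = identitiesOf K R₁ * identitiesOf K R₂)
    (h₁ : codimensionSeries K R₁ ∈ rationalSeries) (h₁' : codimensionSeries K R₁ ∈ B)
    (h₂ : codimensionSeries K R₂ ∈ B) : codimensionSeries K R ∈ B := by
  have h : laplace (borel (codimensionSeries K R₁) * borel (codimensionSeries K R₂)) ∈ B :=
    hB.laplace_mul_mem (by rwa [laplace_borel]) (by rwa [laplace_borel])
  rw [codimensionSeries_eq hT]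
  exact B.add_mem (B.sub_mem (B.add_mem h₁' h₂) h) (B.mul_mem (IsConvolutionClosed.X_mem B)
    (hB.derivative_mem (B.mul_mem (IsConvolutionClosed.X_mem B) h)))

end

theorem rationalSeries_le_algebraicSeries : rationalSeries ≤ algebraicSeries := by
  rintro a ⟨q, hq, p, h⟩
  refine mem_algebraicSeries_of_mul_mem (u := (q : PowerSeries ℂ)) ?_
    (Polynomial.coe_powerSeries_ne_zero hq) (h ▸ ?_)
  all_goals
    rw [← PowerSeries.algebraMap_polynomial_eq_coe]
    exact algebraicSeries.algebraMap_mem _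

theorem theorem2p1 (K : Type*) [Field K] [CharZero K]
    (R₁ R₂ R : Type*) [Ring R₁] [Algebra K R₁] [Ring R₂] [Algebra K R₂] [Ring R] [Algebra K R]
    (h₁ : IsPIAlgebra K R₁) (h₂ : IsPIAlgebra K R₂) (h : IsPIAlgebra K R)
    (hT : identitiesOf K R = identitiesOf K R₁ * identitiesOf K R₂) :
    (IsRationalSeries (codimensionSeries K R₁) → IsRationalSeries (codimensionSeries K R₂) →
      IsRationalSeries (codimensionSeries K R)) ∧
    (IsRationalSeries (codimensionSeries K R₁) → IsAlgebraicSeries (codimensionSeries K R₂) →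
      IsAlgebraicSeries (codimensionSeries K R)) := by
  have : Infinite K := Infinite.of_injective _ (Nat.cast_injective (R := K))
  simp only [isRationalSeries_iff, isAlgebraicSeries_iff]
  exact ⟨fun hr₁ hr₂ => rationalSeries_isConvolutionClosed.codimensionSeries_mem hT hr₁ hr₁ hr₂,
    fun hr₁ ha₂ => algebraicSeries_isConvolutionClosed.codimensionSeries_mem hT hr₁
      (rationalSeries_le_algebraicSeries hr₁) ha₂⟩
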